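/- **Setting.** Let $d\ge 1$, let $\kappa(x,\cdot)$, $x\in\mathbb R^d$, be the conditional law $\mathcal L(Z\mid X=x)$ of a real random variable $Z$ given an $\mathbb R^d$-valued random variable $X$ (a Markov kernel from $\mathbb R^d$ to $\mathbb R$), and let $f(x)=\mathbb E(Z\mid X=x)=\int z\,\kappa(x,dz)$. Assume that $\theta\in\mathbb R^d$ is the unique maximizer of $f$ and put $\mu=f(\theta)$. Let $(a_n)_{n\ge1}$, $(c_n)_{n\ge1}$, $(\tilde a_n)_{n\ge1}$ be positive nonrandom sequences tending to $0$, and let $(e_1,\dots,e_d)$ be the canonical basis of $\mathbb R^d$. Starting from initial values $\theta_1,\mu_1$, define for $n\ge1$ $$\theta_{n+1}=\theta_n+a_nY_n,\qquad Y_n=\frac1{2c_n}\bigl\{Z(\theta_n+c_ne_i)-Z(\theta_n-c_ne_i)\bigr\}_{1\le i\le d},\qquad \mu_{n+1}=(1-\tilde a_n)\mu_n+\tilde a_n\tilde Y_n ,$$ where $\tilde Y_n$ is given by one of the following two schemes. * *Scheme 1 (no additional observations).* $\tilde Y_n=\frac1\delta\sum_{i\in\mathcal S}\{Z(\theta_n+c_ne_i)+Z(\theta_n-c_ne_i)\}$,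 where $\mathcal S\subseteq\{1,\dots,d\}$ is nonempty and $\delta=2\,|\mathcal S|$; in this case put $b_n=c_n$ and $U_{n,k}=0$ for $1\le k\le\delta$. * *Scheme 2 (additional observations).* $\tilde Y_n=\frac1\delta\sum_{k=1}^{\delta}Z_k(\theta_n)$, where $\delta\ge1$ and $Z_1(\theta_n),\dots,Z_\delta(\theta_n)$ are additional observations at $\theta_n$; in this case put $b_n=0$ and $U_{n,k}=Z_k(\theta_n)-f(\theta_n)$. Let $W^{\pm}_{n,i}=Z(\theta_n\pm c_ne_i)-f(\theta_n\pm c_ne_i)$, and let $\mathcal G_n$ be the $\sigma$-field spanned by $\theta_1$ (which adds nothing if $\theta_1$ is nonrandom) and by all $W^+_{q,i},W^-_{q,i},U_{q,k}$ with $1\le i\le d$, $1\le k\le\delta$, $1\le q\le n-1$. An observation at step $n$ at a level $x_n\in\{\theta_n\pm c_ne_i,\theta_n\}$ has conditional law $\kappa(x_n,\cdot)$ given $\mathcal G_n$. Write $(v_n)\in\mathcal{GS}(\beta)$ if $v_n>0$ for all $n\geq 1$ and $\lim_{n\to\infty} n\,[1-v_{n-1}/v_n]=\beta$. Put $s_n=\sum_{k=1}^na_k$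 and $\tilde s_n=\sum_{k=1}^n\tilde a_k$. **Assumptions.** * (A1) $\theta_n\to\theta$ almost surely. * (A2) $f$ is three times continuously differentiable in a neighborhood of $\theta$, and the Hessian $D^2f(\theta)$ is negative definite, with maximal eigenvalue $-L<0$. * (A3) (i) For every $n\ge1$, the variables $W^+_{n,i},W^-_{n,j},U_{n,k}$ ($1\le i,j\le d$, $1\le k\le\delta$) are independent conditionally on $\mathcal G_n$. (ii) For some $\sigma>0$, $\operatorname{Var}(Z\mid X=x)=\sigma^2$ for all $x\in\mathbb R^d$, and for some $m>2$, $\sup_{x\in\mathbb R^d}\mathbb E(|Z|^m\mid X=x)<\infty$. * (A4) (i) $(a_n)\in\mathcal{GS}(-\alpha)$ for some $\alpha\in\,]\max\{1/2,2/m\},1]$. (ii) $(c_n)\in\mathcal{GS}(-\tau)$ for some $\tau\in\,]0,\alpha/2[$. (iii) $\lim_{n\to\infty} na_n\in\,]\max\{\frac{1-2\tau}{2L},\frac{2\tau}{L}\},\infty]$. (iv) $(\tilde a_n)\in\mathcal{GS}(-\tilde\alpha)$ for some $\tilde\alpha\in\,]\max\{1/2,2/m\},1]$. (v) If $\lim_{n\to\infty}\tilde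 a_n^{-1}b_n^4=0$, then $\lim_{n\to\infty}\tilde a_n^{-1/2}a_n\log(s_n)/c_n^2=0$ and $\lim_{n\to\infty}\tilde a_n^{-1}c_n^8=0$; if $\lim_{n\to\infty}\tilde a_n^{-1}b_n^4\in\,]0,\infty]$, then $\sum_n\tilde a_nb_n^4<\infty$ and $\lim_{n\to\infty}a_n\log(s_n)/c_n^4=0$. (vi) $\lim_{n\to\infty} n\tilde a_n\in\,]\tfrac12,\infty]$. **Proposition.** Under (A1)–(A4), for $\mu_n$ defined by either scheme: 1. if $\lim_{n\to\infty}\tilde a_n^{-1}b_n^4=0$, then $|\mu_n-\mu|=O\bigl(\sqrt{\tilde a_n\log\tilde s_n}\bigr)$ almost surely; 2. if $\lim_{n\to\infty}\tilde a_n^{-1}b_n^4\in\,]0,\infty]$, then $|\mu_n-\mu|=O\bigl(\sqrt{\tilde a_n\log\tilde s_n}+b_n^2\bigr)$ almost surely. -/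

import Mathlib

open Filter Topology MeasureTheory ProbabilityTheory Asymptotics
open scoped ENNReal

noncomputable section

namespace KieferWolfowitz

/-- The space `ℝ^d` with its Euclidean structure. -/
abbrev E (d : ℕ) : Type := EuclideanSpace ℝ (Fin d)

/-- The vectors of the canonical basis of `ℝ^d`. -/
def e {d : ℕ} (i : Fin d) : E d := EuclideanSpace.single i (1 : ℝ)

/-- The class `GS(α)`: positive sequences `(v_n)_{n ≥ 1}` with `n (1 - v_{n-1} / v_n) → α`. -/
def GS (α : ℝ) (v : ℕ → ℝ) : Prop :=
  (∀ n, 1 ≤ n → 0 < v n) ∧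
    Tendsto (fun n : ℕ => (n : ℝ) * (1 - v (n - 1) / v n)) atTop (𝓝 α)

/-- The real sequence `u` has a limit, and this limit lies in `]x, +∞]`. -/
def LimAbove (u : ℕ → ℝ) (x : ℝ) : Prop :=
  ∃ l : EReal, (x : EReal) < l ∧ Tendsto (fun n => (u n : EReal)) atTop (𝓝 l)

/-- The partial sums `u_1 + ... + u_n`. -/
def partialSum (u : ℕ → ℝ) (n : ℕ) : ℝ := ∑ k ∈ Finset.Icc 1 n, u k

/-- The regression function `f(x) = E(Z | X = x)`, where `κ x` is the conditional law of `Z`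
given `X = x`. -/
def regression {d : ℕ} (κ : Kernel (E d) ℝ) (x : E d) : ℝ := ∫ z, z ∂(κ x)

/-- The Hessian matrix of `f` at `x`. -/
def hessian {d : ℕ} (f : E d → ℝ) (x : E d) : Matrix (Fin d) (Fin d) ℝ :=
  Matrix.of fun i j => fderiv ℝ (fderiv ℝ f) x (e i) (e j)

/-- The two ways of approximating the size of the maximum:
* `shared S`: reuse the observations at `θ_n ± c_n e_i`, `i ∈ S`, with `S` nonempty;
* `fresh δ`: take `δ ≥ 1` additional observations at `θ_n`. -/
inductive Scheme (d : ℕ) : Type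
  | shared (S : Finset (Fin d)) (hS : S.Nonempty) : Scheme d
  | fresh (δ : ℕ) (hδ : 1 ≤ δ) : Scheme d

namespace Scheme

variable {d : ℕ}

/-- The number `δ` of observations that are averaged at each step. -/
def delta : Scheme d → ℕ
  | shared S _ => 2 * S.card
  | fresh δ _ => δ

/-- Whether additional observations are taken at `θ_n`. -/
def IsFresh : Scheme d → Prop
  | shared _ _ => False
  | fresh _ _ => True

/-- The sequence `b_n`: it is `c_n` for the shared scheme and `0` for the fresh one. -/
def b (D : Scheme d) (c : ℕ → ℝ) (n : ℕ) : ℝ :=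
  match D with
  | shared _ _ => c n
  | fresh _ _ => 0

end Scheme

/-- The random quantities of the double algorithm, for `n ≥ 1` (values at `n = 0` play no role):
the observations `Z(θ_n + c_n e_i)`, `Z(θ_n - c_n e_i)`, the additional observations `Z_k(θ_n)`
(used by the fresh scheme only), the approximations `θ_n` and `μ_n`. -/
structure Run (Ω : Type*) (d : ℕ) (D : Scheme d) where
  Zplus : ℕ → Fin d → Ω → ℝ
  Zminus : ℕ → Fin d → Ω → ℝ
  Zextra : ℕ → Fin D.delta → Ω → ℝ
  theta : ℕ → Ω → E d
  mu : ℕ → Ω → ℝ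

namespace Run

variable {Ω : Type*} {d : ℕ} {D : Scheme d}

/-- `W⁺_{n,i} = Z(θ_n + c_n e_i) - f(θ_n + c_n e_i)`. -/
def Wplus (R : Run Ω d D) (κ : Kernel (E d) ℝ) (c : ℕ → ℝ) (n : ℕ) (i : Fin d) (ω : Ω) : ℝ :=
  R.Zplus n i ω - regression κ (R.theta n ω + c n • e i)

/-- `W⁻_{n,i} = Z(θ_n - c_n e_i) - f(θ_n - c_n e_i)`. -/
def Wminus (R : Run Ω d D) (κ : Kernel (E d) ℝ) (c : ℕ → ℝ) (n : ℕ) (i : Fin d) (ω : Ω) : ℝ :=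
  R.Zminus n i ω - regression κ (R.theta n ω - c n • e i)

/-- `U_{n,k}`: it is `0` for the shared scheme and `Z_k(θ_n) - f(θ_n)` for the fresh one. -/
def U (R : Run Ω d D) (κ : Kernel (E d) ℝ) (n : ℕ) (k : Fin D.delta) (ω : Ω) : ℝ :=
  match D with
  | .shared _ _ => 0
  | .fresh _ _ => R.Zextra n k ω - regression κ (R.theta n ω)

/-- The family of all the observation errors `W⁺_{n,i}`, `W⁻_{n,j}`, `U_{n,k}` of step `n`. -/
def noise (R : Run Ω d D) (κ : Kernel (E d) ℝ) (c : ℕ → ℝ) (n : ℕ) :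
    Fin d ⊕ Fin d ⊕ Fin D.delta → Ω → ℝ :=
  Sum.elim (R.Wplus κ c n) (Sum.elim (R.Wminus κ c n) (R.U κ n))

/-- The σ-field `G_n` spanned by the initial value `θ_1` (which adds nothing when `θ_1` is
nonrandom) and by the observation errors of the steps `1, ..., n - 1`. -/
abbrev past (R : Run Ω d D) (κ : Kernel (E d) ℝ) (c : ℕ → ℝ) (n : ℕ) : MeasurableSpace Ω :=
  MeasurableSpace.comap (R.theta 1) inferInstance ⊔
    ⨆ q ∈ Finset.Ico 1 n, ⨆ j : Fin d ⊕ Fin d ⊕ Fin D.delta,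
      MeasurableSpace.comap (R.noise κ c q j) inferInstance

/-- The approximation `Y_n` of the gradient of `f` at `θ_n`. -/
def Y (R : Run Ω d D) (c : ℕ → ℝ) (n : ℕ) (ω : Ω) : E d :=
  WithLp.toLp 2 fun i => (1 / (2 * c n)) * (R.Zplus n i ω - R.Zminus n i ω)

/-- The approximation of `f(θ_n)`: the average of the `δ` observations used by the scheme. -/
def Ytilde (R : Run Ω d D) (n : ℕ) (ω : Ω) : ℝ :=
  match D with
  | .shared S _ => (1 / (2 * S.card : ℝ)) * ∑ i ∈ S, (R.Zplus n i ω + R.Zminus n i ω)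
  | .fresh δ _ => (1 / (δ : ℝ)) * ∑ k : Fin δ, R.Zextra n k ω

end Run

/-- `ν` is the conditional law of the real random variable `Z` given the σ-field `m`. -/
def HasCondLaw {Ω : Type*} [MeasurableSpace Ω] (P : Measure Ω) (m : MeasurableSpace Ω)
    (Z : Ω → ℝ) (ν : Ω → Measure ℝ) : Prop :=
  ∀ B : Set ℝ, MeasurableSet B → P⟦Z ⁻¹' B | m⟧ =ᵐ[P] fun ω => (ν ω).real B

/-- The real random variables `X_j` are independent conditionally on the σ-field `m`.
(This is `ProbabilityTheory.iCondIndepFun`, which Mathlib defines only when the underlying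
measurable space is standard Borel.) -/
def CondIndependent {Ω : Type*} [MeasurableSpace Ω] (P : Measure Ω) (m : MeasurableSpace Ω)
    {ι : Type*} (X : ι → Ω → ℝ) : Prop :=
  ∀ (s : Finset ι) (B : ι → Set ℝ), (∀ j ∈ s, MeasurableSet (B j)) →
    P⟦⋂ j ∈ s, X j ⁻¹' B j | m⟧ =ᵐ[P] ∏ j ∈ s, P⟦X j ⁻¹' B j | m⟧

/-- `R` is a run of the double algorithm with step sizes `a`, `c`, `ã`, when the observations
`Z(x)` at a level `x` have the law `κ x`. -/
structure IsRun {Ω : Type*} [MeasurableSpace Ω] (P : Measure Ω) {d : ℕ} {D : Scheme d}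
    (κ : Kernel (E d) ℝ) (a c ã : ℕ → ℝ) (R : Run Ω d D) : Prop where
  measurable_theta_one : Measurable (R.theta 1)
  measurable_plus : ∀ n, 1 ≤ n → ∀ i, Measurable (R.Zplus n i)
  measurable_minus : ∀ n, 1 ≤ n → ∀ i, Measurable (R.Zminus n i)
  measurable_extra : D.IsFresh → ∀ n, 1 ≤ n → ∀ k, Measurable (R.Zextra n k)
  law_plus : ∀ n, 1 ≤ n → ∀ i, HasCondLaw P (R.past κ c n) (R.Zplus n i)
    fun ω => κ (R.theta n ω + c n • e i)
  law_minus : ∀ n, 1 ≤ n → ∀ i, HasCondLaw P (R.past κ c n) (R.Zminus n i)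
    fun ω => κ (R.theta n ω - c n • e i)
  law_extra : D.IsFresh → ∀ n, 1 ≤ n → ∀ k, HasCondLaw P (R.past κ c n) (R.Zextra n k)
    fun ω => κ (R.theta n ω)
  theta_succ : ∀ n, 1 ≤ n → ∀ ω, R.theta (n + 1) ω = R.theta n ω + a n • R.Y c n ω
  mu_succ : ∀ n, 1 ≤ n → ∀ ω, R.mu (n + 1) ω = (1 - ã n) * R.mu n ω + ã n * R.Ytilde n ω

/-- `f` is three times continuously differentiable in a neighborhood of `θ`, and its Hessian at
`θ` is negative definite with maximal eigenvalue `-L < 0`. -/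
structure SmoothMax {d : ℕ} (f : E d → ℝ) (θ : E d) (L : ℝ) : Prop where
  contDiffAt : ContDiffAt ℝ 3 f θ
  negDef : (-(hessian f θ)).PosDef
  maxEigenvalue : IsGreatest (spectrum ℝ (hessian f θ)) (-L)
  pos : 0 < L

/-- The assumptions on the observation errors: conditional independence within each step,
constant conditional variance `σ ^ 2`, uniformly bounded conditional moment of order `m > 2`. -/
structure NoiseAssumptions {Ω : Type*} [MeasurableSpace Ω] (P : Measure Ω) {d : ℕ} {D : Scheme d}
    (κ : Kernel (E d) ℝ) (c : ℕ → ℝ) (R : Run Ω d D) (σ m : ℝ) : Prop where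
  condIndep : ∀ n, 1 ≤ n → CondIndependent P (R.past κ c n) (R.noise κ c n)
  sigma_pos : 0 < σ
  variance_eq : ∀ x, Var[fun z => z; κ x] = σ ^ 2
  two_lt : 2 < m
  moment : (⨆ x, ∫⁻ z, ENNReal.ofReal (|z| ^ m) ∂(κ x)) < ∞

/-- The assumptions on the step sizes. -/
structure StepAssumptions {d : ℕ} (D : Scheme d) (a c ã : ℕ → ℝ) (L m α τ αt : ℝ) : Prop where
  a_tendsto : Tendsto a atTop (𝓝 0)
  c_tendsto : Tendsto c atTop (𝓝 0)
  at_tendsto : Tendsto ã atTop (𝓝 0)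
  alpha_mem : α ∈ Set.Ioc (max (1 / 2) (2 / m)) 1
  a_mem : GS (-α) a
  tau_mem : τ ∈ Set.Ioo 0 (α / 2)
  c_mem : GS (-τ) c
  lim_a : LimAbove (fun n => n * a n) (max ((1 - 2 * τ) / (2 * L)) (2 * τ / L))
  alphat_mem : αt ∈ Set.Ioc (max (1 / 2) (2 / m)) 1
  at_mem : GS (-αt) ã
  case_zero : Tendsto (fun n => (ã n)⁻¹ * D.b c n ^ 4) atTop (𝓝 0) →
    Tendsto (fun n => (√(ã n))⁻¹ * a n * Real.log (partialSum a n) / c n ^ 2) atTop (𝓝 0) ∧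
      Tendsto (fun n => (ã n)⁻¹ * c n ^ 8) atTop (𝓝 0)
  case_pos : LimAbove (fun n => (ã n)⁻¹ * D.b c n ^ 4) 0 →
    Summable (fun n => ã n * D.b c n ^ 4) ∧
      Tendsto (fun n => a n * Real.log (partialSum a n) / c n ^ 4) atTop (𝓝 0)
  lim_at : LimAbove (fun n => n * ã n) (1 / 2)

end KieferWolfowitz

end

/-! Up to a bias, both algorithms are linear recursions. Each error splits into the solution of a
scalar linear recursion driven by the observation errors and a remainder contracted by the drift.

Noise: let `M_{n+1} = (1 - λ γ_n) M_n + (γ_n / c_n) ε_n` with martingale differences `ε_n`, and let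
`s_n` be the partial sums of `γ`. With `x_n = c_n √(log s_n / γ_n)`, the process `exp (x_n M_n) +
exp (-x_n M_n)`, multiplied by `s_n ^ (-A)` for a suitable `A`, is a supermartingale up to errors of
order `γ_n / s_n²`: the contraction of the recursion pays, through convexity of `exp`, for the
variance of the new error. These errors are summable, so `x_n |M_n| ≤ K + A log s_n` almost surely,
that is, `M_n = O(√(γ_n log s_n) / c_n)` (`IsNoise.ae_isBigO`). Exponential moments require
truncated errors; since `α > 2 / m`, Borel-Cantelli shows that only finitely many truncations act.

Remainder: `r_{n+1} ≤ (1 - λ γ_n) r_n + C γ_n v_n` forces `r = O(v)` when `v` decays more slowly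
than the homogeneous solutions (`isBigO_of_contraction`). The lower bounds on `n a_n` and `n ã_n`
ensure this for the sequences `v` that occur.

For `θ_n`, the mean of `Y_n` is `D²f(θ)(θ_n - θ)` up to `o(‖θ_n - θ‖) + O(c_n²)`, and `D²f(θ) ≤ -L`,
so `θ_n - θ = O(√(a_n log s_n) / c_n + c_n²)` (`IsRun.ae_theta_isBigO`). For `μ_n`, the gradient
vanishes at `θ`, so the bias is quadratic, `O(‖θ_n - θ‖² + b_n²)` (`exists_Ytilde_decomposition`).
Assumption (A4)(v) compares it with `√ã_n` in the first case and with `c_n²` in the second. -/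

namespace KieferWolfowitz

/-! ### Power-like rates and the deterministic contraction lemma -/

/-- `v` is eventually positive and `n (v_n / v_{n+1} - 1) → β`, so that `v_n` decreases roughly
like `n ^ (-β)`. -/
def HasRate (β : ℝ) (v : ℕ → ℝ) : Prop :=
  (∀ᶠ n in atTop, 0 < v n) ∧
    Tendsto (fun n : ℕ => (n : ℝ) * (v n / v (n + 1) - 1)) atTop (𝓝 β)

theorem tendsto_of_natCast_mul {r : ℕ → ℝ} {β : ℝ}
    (h : Tendsto (fun n : ℕ => (n : ℝ) * r n) atTop (𝓝 β)) : Tendsto r atTop (𝓝 0) := by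
  have h1 := h.mul (tendsto_inv_atTop_nhds_zero_nat (𝕜 := ℝ))
  rw [mul_zero] at h1
  refine h1.congr' ?_
  filter_upwards [eventually_gt_atTop 0] with n hn
  have : (n : ℝ) ≠ 0 := by positivity
  field_simp

/-- Shifting the index replaces `n (1 - v_{n-1} / v_n)` by `-(n + 1) r_n` with `r_n = v_n / v_{n+1}
- 1`; the surplus `r_n` tends to `0`. The ratio form is convenient because it passes to products,
inverses and square roots. -/
theorem GS.hasRate {β : ℝ} {v : ℕ → ℝ} (h : GS (-β) v) : HasRate β v := by
  refine ⟨eventually_atTop.mpr ⟨1, h.1⟩, ?_⟩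
  have h1 := (tendsto_add_atTop_iff_nat 1).mpr h.2.neg
  simp only [neg_neg, Nat.add_sub_cancel] at h1
  set r : ℕ → ℝ := fun n => v n / v (n + 1) - 1 with hr
  have h2 : Tendsto (fun n : ℕ => ((n : ℝ) + 1) * r n) atTop (𝓝 β) := by
    refine h1.congr fun n => ?_
    simp only [hr]
    push_cast
    ring
  have h3 : Tendsto r atTop (𝓝 0) := by
    have h4 := h2.mul (tendsto_one_div_add_atTop_nhds_zero_nat (𝕜 := ℝ))
    rw [mul_zero] at h4
    refine h4.congr fun n => ?_
    have : (n : ℝ) + 1 ≠ 0 := by positivity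
    field_simp
  have h5 := h2.sub h3
  rw [sub_zero] at h5
  exact h5.congr fun n => by ring

theorem HasRate.tendsto_ratio {β : ℝ} {v : ℕ → ℝ} (h : HasRate β v) :
    Tendsto (fun n => v n / v (n + 1)) atTop (𝓝 1) := by
  have := (tendsto_of_natCast_mul h.2).add_const 1
  simpa using this

theorem HasRate.mul {β β' : ℝ} {v w : ℕ → ℝ} (hv : HasRate β v) (hw : HasRate β' w) :
    HasRate (β + β') fun n => v n * w n := by
  refine ⟨by filter_upwards [hv.1, hw.1] with n h1 h2 using mul_pos h1 h2, ?_⟩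
  have h := (hv.2.mul hw.tendsto_ratio).add hw.2
  rw [mul_one] at h
  refine h.congr fun n => ?_
  rw [mul_div_mul_comm]
  ring

theorem HasRate.inv {β : ℝ} {v : ℕ → ℝ} (hv : HasRate β v) :
    HasRate (-β) fun n => (v n)⁻¹ := by
  refine ⟨by filter_upwards [hv.1] with n h1 using inv_pos.mpr h1, ?_⟩
  have h := hv.2.neg.mul (hv.tendsto_ratio.inv₀ one_ne_zero)
  rw [inv_one, mul_one] at h
  refine h.congr' ?_
  filter_upwards [hv.1, (tendsto_add_atTop_nat 1).eventually hv.1] with n h1 h2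
  field_simp
  ring

theorem HasRate.sqrt {β : ℝ} {v : ℕ → ℝ} (hv : HasRate β v) :
    HasRate (β / 2) fun n => √(v n) := by
  refine ⟨by filter_upwards [hv.1] with n h1 using Real.sqrt_pos.mpr h1, ?_⟩
  have h1 := (hv.tendsto_ratio.sqrt).add_const 1
  rw [Real.sqrt_one] at h1
  have h := hv.2.div h1 (by norm_num)
  norm_num at h
  refine h.congr' ?_
  filter_upwards [hv.1, (tendsto_add_atTop_nat 1).eventually hv.1] with n hn hn'
  rw [← Real.sqrt_div hn.le, Pi.div_apply]
  have h2 : √(v n / v (n + 1)) + 1 ≠ 0 := by positivity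
  have h3 := Real.sq_sqrt (div_pos hn hn').le
  rw [div_eq_iff h2]
  linear_combination (-(n : ℝ)) * h3

/-- `v` decreases more slowly than the solutions of `r_{n+1} = (1 - lam γ_n) r_n`. -/
def Dominates (lam : ℝ) (γ v : ℕ → ℝ) : Prop :=
  (∀ᶠ n in atTop, 0 < v n) ∧
    ∃ κ > 0, ∀ᶠ n in atTop, (1 - lam * γ n) * v n ≤ (1 - κ * γ n) * v (n + 1)

/-- A positive step size sequence that decreases to `0` roughly like `n ^ (-α)`, and not faster
than `q / n`. -/
structure IsStep (γ : ℕ → ℝ) (α q : ℝ) : Prop where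
  pos : ∀ n, 1 ≤ n → 0 < γ n
  tendsto : Tendsto γ atTop (𝓝 0)
  rate : HasRate α γ
  q_pos : 0 < q
  lower : ∀ᶠ n : ℕ in atTop, q ≤ n * γ n

theorem IsStep.eventually_pos {γ : ℕ → ℝ} {α q : ℝ} (h : IsStep γ α q) :
    ∀ᶠ n in atTop, 0 < γ n := eventually_atTop.mpr ⟨1, h.pos⟩

theorem IsStep.eventually_mul_lt {γ : ℕ → ℝ} {α q : ℝ} (h : IsStep γ α q) (a : ℝ) {b : ℝ}
    (hb : 0 < b) : ∀ᶠ n in atTop, a * γ n < b := by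
  have := h.tendsto.const_mul a
  rw [mul_zero] at this
  exact this.eventually_lt_const hb

/-- A rate `β < b` gives `v_n / v_{n+1} ≤ 1 + b / n`, and `1 / n ≤ γ_n / q` turns this into `1 + k
γ_n` with `k = b / q < lam`. The product `(1 - lam γ_n)(1 + k γ_n)` is then at most `1 - (lam - k)
γ_n`. -/
theorem HasRate.dominates {γ v : ℕ → ℝ} {α q β lam : ℝ} (hγ : IsStep γ α q) (hv : HasRate β v)
    (hlam : 0 < lam) (hβ : β < lam * q) : Dominates lam γ v := by
  obtain ⟨b, hb1, hb2⟩ := exists_between (max_lt hβ (mul_pos hlam hγ.q_pos))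
  have hb0 : 0 < b := (le_max_right _ _).trans_lt hb1
  have hq := hγ.q_pos
  set k := b / q with hk
  have hk0 : 0 < k := by positivity
  have hklam : k < lam := by rwa [hk, div_lt_iff₀ hq]
  refine ⟨hv.1, lam - k, sub_pos.mpr hklam, ?_⟩
  filter_upwards [hv.2.eventually_lt_const ((le_max_left _ _).trans_lt hb1), hγ.lower,
    hγ.eventually_mul_lt lam one_pos, hγ.eventually_pos, eventually_gt_atTop 0,
    (tendsto_add_atTop_nat 1).eventually hv.1] with n h1 h2 h3 h4 h5 h6
  have hn : (0 : ℝ) < n := by exact_mod_cast h5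
  have h7 : v n / v (n + 1) ≤ 1 + k * γ n := by
    have : v n / v (n + 1) - 1 ≤ k * γ n := by
      have h8 : (n : ℝ) * (v n / v (n + 1) - 1) ≤ n * (k * γ n) := by
        refine h1.le.trans ?_
        calc b = k * q := by rw [hk, div_mul_cancel₀ _ hq.ne']
          _ ≤ k * (n * γ n) := by gcongr
          _ = _ := by ring
      exact le_of_mul_le_mul_left h8 hn
    linarith
  rw [div_le_iff₀ h6] at h7
  calc (1 - lam * γ n) * v n ≤ (1 - lam * γ n) * ((1 + k * γ n) * v (n + 1)) :=
        mul_le_mul_of_nonneg_left h7 (by linarith)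
    _ = (1 - (lam - k) * γ n - lam * k * γ n ^ 2) * v (n + 1) := by ring
    _ ≤ _ := by
        refine mul_le_mul_of_nonneg_right ?_ h6.le
        have : 0 ≤ lam * k * γ n ^ 2 := by positivity
        linarith

theorem Dominates.add {γ v w : ℕ → ℝ} {α q lam : ℝ} (hγ : IsStep γ α q)
    (hv : Dominates lam γ v) (hw : Dominates lam γ w) :
    Dominates lam γ fun n => v n + w n := by
  obtain ⟨hv0, κ, hκ, hv⟩ := hv
  obtain ⟨hw0, κ', hκ', hw⟩ := hw
  refine ⟨by filter_upwards [hv0, hw0] with n h1 h2 using add_pos h1 h2, min κ κ',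
    lt_min hκ hκ', ?_⟩
  filter_upwards [hv, hw, hγ.eventually_pos, (tendsto_add_atTop_nat 1).eventually hv0,
    (tendsto_add_atTop_nat 1).eventually hw0] with n h1 h2 h3 h4 h5
  have h6 := mul_le_mul_of_nonneg_right (mul_le_mul_of_nonneg_right (min_le_left κ κ') h3.le) h4.le
  have h7 := mul_le_mul_of_nonneg_right (mul_le_mul_of_nonneg_right (min_le_right κ κ') h3.le) h5.le
  linarith

theorem Dominates.eventually_le_two_mul {γ v : ℕ → ℝ} {α q lam : ℝ} (hγ : IsStep γ α q)
    (hv : Dominates lam γ v) : ∀ᶠ n in atTop, v n ≤ 2 * v (n + 1) := by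
  obtain ⟨hv0, κ, hκ, hv⟩ := hv
  filter_upwards [hv, hv0, hγ.eventually_pos, (tendsto_add_atTop_nat 1).eventually hv0,
    hγ.eventually_mul_lt lam one_half_pos] with n h1 h2 h3 h4 h5
  have : 0 ≤ κ * γ n * v (n + 1) := by positivity
  nlinarith

theorem isBigO_of_contraction {γ v r : ℕ → ℝ} {α q lam C : ℝ} (hγ : IsStep γ α q)
    (hv : Dominates lam γ v) (hC : 0 ≤ C) (hr : ∀ n, 0 ≤ r n)
    (hrec : ∀ᶠ n in atTop, r (n + 1) ≤ (1 - lam * γ n) * r n + C * γ n * v n) :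
    r =O[atTop] v := by
  have h2v := hv.eventually_le_two_mul hγ
  obtain ⟨hv0, κ, hκ, hv⟩ := hv
  obtain ⟨N, hN⟩ := eventually_atTop.mp (((hv.and hv0).and (h2v.and hrec)).and
    (hγ.eventually_pos.and (hγ.eventually_mul_lt lam one_pos)))
  -- The first entry starts the induction. The second lets the gain `κ γ_n K v_{n+1}` absorb the
  -- forcing `C γ_n v_n`, the factor 2 coming from `v_n ≤ 2 v_{n+1}`.
  set K := max (r N / v N) (2 * C / κ) with hK
  have hKC : 2 * C ≤ K * κ := by
    rw [← div_le_iff₀ hκ]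
    exact le_max_right _ _
  have key : ∀ n, N ≤ n → r n ≤ K * v n := by
    intro n hn
    induction n, hn using Nat.le_induction with
    | base =>
      rw [← div_le_iff₀ (hN N le_rfl).1.1.2]
      exact le_max_left _ _
    | succ n hn ih =>
      obtain ⟨⟨⟨h1, h2⟩, h3, h4⟩, h5, h6⟩ := hN n hn
      have h7 := (hN (n + 1) (by omega)).1.1.2
      have hK0 : 0 ≤ K := (by positivity : 0 ≤ 2 * C / κ).trans (le_max_right _ _)
      have e1 : (1 - lam * γ n) * r n ≤ (1 - lam * γ n) * (K * v n) :=
        mul_le_mul_of_nonneg_left ih (by linarith)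
      have e2 := mul_le_mul_of_nonneg_left h1 hK0
      have e3 : C * γ n * v n ≤ C * γ n * (2 * v (n + 1)) :=
        mul_le_mul_of_nonneg_left h3 (by positivity)
      have e4 := mul_le_mul_of_nonneg_right hKC (by positivity : 0 ≤ γ n * v (n + 1))
      nlinarith
  refine IsBigO.of_bound K ?_
  filter_upwards [eventually_ge_atTop N] with n hn
  rw [Real.norm_of_nonneg (hr n), Real.norm_of_nonneg (hN n hn).1.1.2.le]
  exact key n hn

/-! ### Partial sums of step sizes, their logarithms, and summability -/

theorem partialSum_succ (γ : ℕ → ℝ) (n : ℕ) :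
    partialSum γ (n + 1) = partialSum γ n + γ (n + 1) := by
  simp only [partialSum]
  rw [Finset.sum_Icc_succ_top (by omega)]

theorem IsStep.partialSum_pos {γ : ℕ → ℝ} {α q : ℝ} (h : IsStep γ α q) {n : ℕ} (hn : 1 ≤ n) :
    0 < partialSum γ n :=
  Finset.sum_pos (fun k hk => h.pos k (Finset.mem_Icc.mp hk).1) ⟨1, by simp [hn]⟩

theorem IsStep.partialSum_mono {γ : ℕ → ℝ} {α q : ℝ} (h : IsStep γ α q) :
    Monotone (partialSum γ) :=
  monotone_nat_of_le_succ fun n => by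
    rw [partialSum_succ]
    linarith [h.pos (n + 1) (by omega)]

theorem partialSum_eq_sum_range (γ : ℕ → ℝ) (n : ℕ) :
    partialSum γ n = ∑ k ∈ Finset.range n, γ (k + 1) := by
  induction n with
  | zero => simp [partialSum]
  | succ n ih => rw [partialSum_succ, Finset.sum_range_succ, ih]

theorem IsStep.tendsto_partialSum {γ : ℕ → ℝ} {α q : ℝ} (h : IsStep γ α q) :
    Tendsto (partialSum γ) atTop atTop := by
  have h1 : ¬ Summable fun k => γ (k + 1) := by
    rw [summable_nat_add_iff 1]
    intro hs
    refine Real.not_summable_natCast_inv (summable_of_isBigO_nat hs ?_)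
    refine IsBigO.of_bound q⁻¹ ?_
    filter_upwards [h.lower, h.eventually_pos, eventually_gt_atTop 0] with n h2 h3 h4
    have hn : (0 : ℝ) < n := by exact_mod_cast h4
    rw [Real.norm_of_nonneg (by positivity), Real.norm_of_nonneg h3.le,
      ← div_eq_inv_mul, le_div_iff₀ h.q_pos, inv_mul_le_iff₀ hn]
    exact h2
  rw [not_summable_iff_tendsto_nat_atTop_of_nonneg fun k => (h.pos _ (by omega)).le] at h1
  exact h1.congr fun n => (partialSum_eq_sum_range γ n).symm

theorem IsStep.tendsto_log {γ : ℕ → ℝ} {α q : ℝ} (h : IsStep γ α q) :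
    Tendsto (fun n => Real.log (partialSum γ n)) atTop atTop :=
  Real.tendsto_log_atTop.comp h.tendsto_partialSum

theorem IsStep.eventually_step_le {γ : ℕ → ℝ} {α q : ℝ} (h : IsStep γ α q) :
    ∀ᶠ n in atTop, γ (n + 1) ≤ 2 * γ n := by
  filter_upwards [h.rate.tendsto_ratio.eventually_const_lt (by norm_num : (1 / 2 : ℝ) < 1),
    eventually_ge_atTop 1] with n h1 h2
  rw [lt_div_iff₀ (h.pos _ (by omega))] at h1
  linarith

/-- The increment of the logarithm is at most `γ_{n+1} / s_n ≤ 2 γ_n`, which is below `δ γ_n log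
s_n` once `log s_n ≥ 2 / δ`. -/
theorem IsStep.eventually_log_le {γ : ℕ → ℝ} {α q : ℝ} (h : IsStep γ α q) {δ : ℝ} (hδ : 0 < δ) :
    ∀ᶠ n in atTop, Real.log (partialSum γ (n + 1)) ≤
      (1 + δ * γ n) * Real.log (partialSum γ n) := by
  filter_upwards [h.eventually_step_le, h.eventually_pos,
    h.tendsto_partialSum.eventually_ge_atTop 1, h.tendsto_log.eventually_ge_atTop (2 / δ)]
    with n h1 h2 h3 h4
  have hs : 0 < partialSum γ n := by linarith
  have hs' : 0 < partialSum γ (n + 1) := hs.trans_le (h.partialSum_mono n.le_succ)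
  have h5 := Real.log_le_sub_one_of_pos (div_pos hs' hs)
  rw [Real.log_div hs'.ne' hs.ne', partialSum_succ, add_div, div_self hs.ne'] at h5
  have h6 : γ (n + 1) / partialSum γ n ≤ γ (n + 1) :=
    div_le_self (h.pos _ (by omega)).le h3
  rw [div_le_iff₀ hδ] at h4
  rw [partialSum_succ]
  nlinarith

theorem IsStep.dominates_mul_sqrt_log {γ y : ℕ → ℝ} {α q lam : ℝ} (h : IsStep γ α q)
    (hy : Dominates lam γ y) :
    Dominates lam γ fun n => y n * √(Real.log (partialSum γ n)) := by
  obtain ⟨hy0, κ, hκ, hy⟩ := hy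
  refine ⟨?_, κ, hκ, ?_⟩
  · filter_upwards [hy0, h.tendsto_log.eventually_gt_atTop 0] with n h1 h2
      using mul_pos h1 (Real.sqrt_pos.mpr h2)
  · filter_upwards [hy, (tendsto_add_atTop_nat 1).eventually hy0,
      h.eventually_mul_lt κ one_pos, eventually_ge_atTop 1] with n h1 h2 h3 hn
    have h4 : √(Real.log (partialSum γ n)) ≤ √(Real.log (partialSum γ (n + 1))) :=
      Real.sqrt_le_sqrt (Real.log_le_log (h.partialSum_pos hn) (h.partialSum_mono n.le_succ))
    calc (1 - lam * γ n) * (y n * √(Real.log (partialSum γ n)))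
        = (1 - lam * γ n) * y n * √(Real.log (partialSum γ n)) := by ring
      _ ≤ (1 - κ * γ n) * y (n + 1) * √(Real.log (partialSum γ n)) := by gcongr
      _ ≤ (1 - κ * γ n) * y (n + 1) * √(Real.log (partialSum γ (n + 1))) :=
          mul_le_mul_of_nonneg_left h4 (mul_nonneg (by linarith) h2.le)
      _ = _ := by ring

/-- This provides the contraction of `x_n M_n` when `x_n = √(log s_n) / y_n`. Domination gains `1 -
κ γ_n` and the growth of `√(log s_n)` costs only `1 + κ γ_n / 2`, so half of the gain survives. -/
theorem IsStep.eventually_scale_contract {γ y : ℕ → ℝ} {α q lam : ℝ} (h : IsStep γ α q)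
    (hy : Dominates lam γ y) :
    ∃ κ > 0, ∀ᶠ n in atTop, √(Real.log (partialSum γ (n + 1))) / y (n + 1) * (1 - lam * γ n) ≤
      (1 - κ * γ n) * (√(Real.log (partialSum γ n)) / y n) := by
  obtain ⟨hy0, κ, hκ, hy⟩ := hy
  refine ⟨κ / 2, half_pos hκ, ?_⟩
  filter_upwards [hy, hy0, (tendsto_add_atTop_nat 1).eventually hy0,
    h.eventually_mul_lt κ one_pos, h.eventually_log_le hκ, h.eventually_pos,
    h.tendsto_log.eventually_gt_atTop 0, h.eventually_mul_lt lam one_pos]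
    with n h1 h2 h3 h4 h5 h6 h7 hlt
  have h8 : √(Real.log (partialSum γ (n + 1))) ≤
      (1 + κ / 2 * γ n) * √(Real.log (partialSum γ n)) := by
    have h9 : 0 ≤ 1 + κ / 2 * γ n := by positivity
    rw [← Real.sqrt_sq h9, ← Real.sqrt_mul (sq_nonneg _)]
    refine Real.sqrt_le_sqrt (h5.trans (mul_le_mul_of_nonneg_right ?_ h7.le))
    nlinarith [sq_nonneg (κ / 2 * γ n)]
  have h10 : (1 - lam * γ n) / y (n + 1) ≤ (1 - κ * γ n) / y n := by
    rw [div_le_div_iff₀ h3 h2]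
    exact h1
  have h11 : 0 ≤ (1 - κ * γ n) / y n := div_nonneg (by linarith) h2.le
  calc √(Real.log (partialSum γ (n + 1))) / y (n + 1) * (1 - lam * γ n)
      = √(Real.log (partialSum γ (n + 1))) * ((1 - lam * γ n) / y (n + 1)) := by ring
    _ ≤ (1 + κ / 2 * γ n) * √(Real.log (partialSum γ n)) * ((1 - κ * γ n) / y n) :=
        mul_le_mul h8 h10 (div_nonneg (by linarith) h3.le) (by positivity)
    _ = (1 + κ / 2 * γ n) * (1 - κ * γ n) * (√(Real.log (partialSum γ n)) / y n) := by ring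
    _ ≤ _ := by
        refine mul_le_mul_of_nonneg_right ?_ (by positivity)
        have : 0 ≤ κ * γ n * (κ * γ n) := by positivity
        nlinarith

/-- The sequence `v_n n ^ b` is eventually nonincreasing: Bernoulli's inequality for exponents in
`[0, 1]` bounds `(1 + 1 / n) ^ b` by `1 + b / n`, which is eventually below `v_n / v_{n+1}`. -/
theorem HasRate.exists_le_rpow {v : ℕ → ℝ} {β b : ℝ} (hv : HasRate β v) (hb0 : 0 ≤ b)
    (hb1 : b ≤ 1) (hb : b < β) : ∃ C > 0, ∀ᶠ n : ℕ in atTop, v n ≤ C * (n : ℝ) ^ (-b) := by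
  have hev : ∀ᶠ n : ℕ in atTop, 0 < v n ∧ v (n + 1) * ((n : ℝ) + 1) ^ b ≤ v n * (n : ℝ) ^ b := by
    filter_upwards [hv.2.eventually_const_lt hb, hv.1,
      (tendsto_add_atTop_nat 1).eventually hv.1, eventually_gt_atTop 0] with n h1 h2 h3 h4
    refine ⟨h2, ?_⟩
    have hn : (0 : ℝ) < n := by exact_mod_cast h4
    have h5 : (1 + 1 / (n : ℝ)) ^ b ≤ 1 + b * (1 / n) :=
      rpow_one_add_le_one_add_mul_self (by linarith [(by positivity : 0 ≤ 1 / (n : ℝ))]) hb0 hb1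
    have h6 : 1 + b * (1 / (n : ℝ)) ≤ v n / v (n + 1) := by
      have : b / n ≤ v n / v (n + 1) - 1 := by
        rw [div_le_iff₀ hn]
        linarith
      rw [mul_one_div]
      linarith
    have h7 := h5.trans h6
    have h8 : (1 + 1 / (n : ℝ)) = (n + 1) / n := by field_simp
    rw [h8, Real.div_rpow (by positivity) hn.le, div_le_div_iff₀ (by positivity) h3] at h7
    linarith
  obtain ⟨N, hN⟩ := eventually_atTop.mp (hev.and (eventually_gt_atTop 0))
  have hNpos : (0 : ℝ) < N := by exact_mod_cast (hN N le_rfl).2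
  refine ⟨v N * (N : ℝ) ^ b, mul_pos (hN N le_rfl).1.1 (by positivity), ?_⟩
  filter_upwards [eventually_ge_atTop N] with n hn
  have hn0 : (0 : ℝ) < n := by exact_mod_cast (hN n hn).2
  rw [Real.rpow_neg hn0.le, ← div_eq_mul_inv, le_div_iff₀ (by positivity)]
  induction n, hn using Nat.le_induction with
  | base => exact le_rfl
  | succ n hn ih =>
    have := (hN n hn).1.2
    push_cast
    exact this.trans (ih (by exact_mod_cast (hN n hn).2))

theorem IsStep.summable_div_sq {γ : ℕ → ℝ} {α q : ℝ} (h : IsStep γ α q) :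
    Summable fun n => γ n / partialSum γ n ^ 2 := by
  -- The telescoping bound `γ_k / s_k² ≤ 1 / s_{k-1} - 1 / s_k` needs `s_{k-1} > 0`. Since `s_0 =
  -- 0`, it starts at `k = 2`.
  rw [← summable_nat_add_iff 2]
  refine summable_of_sum_range_le (c := (partialSum γ 1)⁻¹) (fun n => ?_) fun n => ?_
  · exact div_nonneg (h.pos _ (by omega)).le (sq_nonneg _)
  · have key : ∑ k ∈ Finset.range n, γ (k + 2) / partialSum γ (k + 2) ^ 2 ≤
        (partialSum γ 1)⁻¹ - (partialSum γ (n + 1))⁻¹ := by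
      induction n with
      | zero => simp
      | succ n ih =>
        rw [Finset.sum_range_succ]
        have h1 : 0 < partialSum γ (n + 1) := h.partialSum_pos (by omega)
        have h2 : 0 < partialSum γ (n + 2) := h.partialSum_pos (by omega)
        have h3 := h.pos (n + 2) (by omega)
        have h4 : γ (n + 2) / partialSum γ (n + 2) ^ 2 ≤
            (partialSum γ (n + 1))⁻¹ - (partialSum γ (n + 2))⁻¹ := by
          rw [inv_sub_inv h1.ne' h2.ne', partialSum_succ γ (n + 1), add_sub_cancel_left,
            ← partialSum_succ γ (n + 1)]
          refine div_le_div_of_nonneg_left h3.le (by positivity) ?_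
          rw [sq]
          exact mul_le_mul_of_nonneg_right (h.partialSum_mono (by omega)) h2.le
        linarith
    have := inv_pos.mpr (h.partialSum_pos (n := n + 1) (by omega))
    linarith

/-- For `2 / m < b < α`, `γ_n = O(n ^ (-b))`, while the logarithm is `O(n ^ δ)` for every `δ > 0`.
Taking `δ` equal to half of `b - 2 / m` keeps `(b - δ) m / 2 > 1`. -/
theorem IsStep.summable_mul_log_rpow {γ : ℕ → ℝ} {α q m : ℝ} (h : IsStep γ α q) (hm : 2 < m)
    (hα : 2 / m < α) (hα1 : α ≤ 1) :
    Summable fun n => (γ n * Real.log (partialSum γ n)) ^ (m / 2) := by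
  obtain ⟨b, hb1, hb2⟩ := exists_between hα
  have hm0 : 0 < m := by linarith
  have hb0 : 0 < b := lt_trans (by positivity) hb1
  obtain ⟨C, hC, hγ⟩ := h.rate.exists_le_rpow hb0.le (hb2.le.trans hα1) hb2
  set δ := (b - 2 / m) / 2 with hδ
  have hδ0 : 0 < δ := by rw [hδ]; linarith
  obtain ⟨K, hK⟩ := h.tendsto.bddAbove_range
  have hKγ : ∀ n, γ n ≤ K := fun n => hK ⟨n, rfl⟩
  have hK0 : 0 < K := (h.pos 1 le_rfl).trans_le (hKγ 1)
  have hs : ∀ n : ℕ, partialSum γ n ≤ K * n := by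
    intro n
    refine (Finset.sum_le_card_nsmul _ _ K fun k _ => hKγ k).trans ?_
    simp [mul_comm]
  have hlog : ∀ᶠ n : ℕ in atTop, Real.log (partialSum γ n) ≤ K ^ δ * (n : ℝ) ^ δ := by
    have ht : Tendsto (fun n : ℕ => K * (n : ℝ)) atTop atTop :=
      tendsto_natCast_atTop_atTop.const_mul_atTop hK0
    filter_upwards [ht.eventually ((isLittleO_log_rpow_atTop hδ0).bound one_pos),
      eventually_ge_atTop 1] with n h1 hn
    refine (Real.log_le_log (h.partialSum_pos hn) (hs n)).trans ?_
    rw [one_mul, Real.norm_eq_abs, Real.norm_of_nonneg (by positivity),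
      Real.mul_rpow hK0.le (by positivity)] at h1
    exact (le_abs_self _).trans h1
  have hexp : -((b - δ) * (m / 2)) < -1 := by
    have : (2 / m) * (m / 2) = 1 := by field_simp
    have h2 : 2 / m < b - δ := by rw [hδ]; linarith
    have := mul_lt_mul_of_pos_right h2 (by positivity : 0 < m / 2)
    linarith
  refine summable_of_isBigO_nat (Real.summable_nat_rpow.mpr hexp) ?_
  refine IsBigO.of_bound ((C * K ^ δ) ^ (m / 2)) ?_
  filter_upwards [hγ, hlog, h.eventually_pos, h.tendsto_log.eventually_gt_atTop 0,
    eventually_gt_atTop 0] with n h1 h2 h3 h4 h5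
  have hn : (0 : ℝ) < n := by exact_mod_cast h5
  rw [Real.norm_of_nonneg (by positivity), Real.norm_of_nonneg (by positivity)]
  have h6 : γ n * Real.log (partialSum γ n) ≤ C * K ^ δ * (n : ℝ) ^ (-(b - δ)) := by
    calc γ n * Real.log (partialSum γ n) ≤ (C * (n : ℝ) ^ (-b)) * (K ^ δ * (n : ℝ) ^ δ) := by
          gcongr
      _ = C * K ^ δ * ((n : ℝ) ^ (-b) * (n : ℝ) ^ δ) := by ring
      _ = _ := by rw [← Real.rpow_add hn]; ring_nf
  calc (γ n * Real.log (partialSum γ n)) ^ (m / 2)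
      ≤ (C * K ^ δ * (n : ℝ) ^ (-(b - δ))) ^ (m / 2) := by gcongr
    _ = _ := by
        rw [Real.mul_rpow (by positivity) (by positivity), ← Real.rpow_mul hn.le, neg_mul]

/-! ### Exponential supermartingale bound for noisy linear recursions -/

/-- A nonnegative process whose conditional increments are at most the terms of a convergent
series is almost surely bounded. -/
theorem ae_bddAbove_of_almost_supermartingale {Ω : Type*} {mΩ : MeasurableSpace Ω}
    {P : Measure Ω} [IsProbabilityMeasure P] (F : Filtration ℕ mΩ) (Y : ℕ → Ω → ℝ) (r : ℕ → ℝ)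
    (hadp : StronglyAdapted F Y) (hint : ∀ n, Integrable (Y n) P) (hpos : ∀ n ω, 0 ≤ Y n ω)
    (hr : ∀ n, 0 ≤ r n) (hsum : Summable r)
    (hstep : ∀ n, P[Y (n + 1) | F n] ≤ᵐ[P] fun ω => Y n ω + r n) :
    ∀ᵐ ω ∂P, ∃ K, ∀ n, Y n ω ≤ K := by
  set ρ : ℕ → ℝ := fun n => ∑ k ∈ Finset.range n, r k with hρ
  have hρ_le : ∀ n, ρ n ≤ ∑' k, r k := fun n => hsum.sum_le_tsum _ fun k _ => hr k
  have hρ_nonneg : ∀ n, 0 ≤ ρ n := fun n => Finset.sum_nonneg fun k _ => hr k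
  -- Compensated and negated, the process is a submartingale. It is bounded in `L¹` because the
  -- means of `Y` grow by at most the sum of `r`, so Doob's theorem gives almost sure convergence
  -- and hence a lower bound along the path.
  set V : ℕ → Ω → ℝ := fun n ω => ρ n - Y n ω with hV
  have hVint : ∀ n, Integrable (V n) P := fun n => (integrable_const _).sub (hint n)
  have hsub : Submartingale V F P := by
    refine submartingale_nat (fun n => stronglyMeasurable_const.sub (hadp n)) hVint fun n => ?_
    have h1 : P[V (n + 1) | F n] =ᵐ[P]
        P[fun _ : Ω => ρ (n + 1) | F n] - P[Y (n + 1) | F n] :=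
      condExp_sub (integrable_const _) (hint (n + 1)) _
    rw [condExp_const (F.le n)] at h1
    filter_upwards [h1, hstep n] with ω h1 h2
    rw [h1]
    simp only [hV, Pi.sub_apply, hρ, Finset.sum_range_succ]
    linarith
  have hmean : ∀ n, ∫ ω, Y n ω ∂P ≤ ∫ ω, Y 0 ω ∂P + ρ n := by
    intro n
    induction n with
    | zero => simp [hρ]
    | succ n ih =>
      have h1 : ∫ ω, Y (n + 1) ω ∂P ≤ ∫ ω, (Y n ω + r n) ∂P := by
        rw [← integral_condExp (F.le n)]
        exact integral_mono_ae integrable_condExp ((hint n).add (integrable_const _)) (hstep n)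
      rw [integral_add (hint n) (integrable_const _)] at h1
      simp only [integral_const, probReal_univ, smul_eq_mul, one_mul] at h1
      simp only [hρ, Finset.sum_range_succ] at ih ⊢
      linarith
  have hbdd : ∀ n, eLpNorm (V n) 1 P ≤
      ((∫ ω, Y 0 ω ∂P + 2 * ∑' k, r k).toNNReal : ℝ≥0∞) := by
    intro n
    rw [eLpNorm_one_eq_lintegral_enorm, ← ofReal_integral_norm_eq_lintegral_enorm (hVint n)]
    apply ENNReal.ofReal_le_ofReal
    calc ∫ ω, ‖V n ω‖ ∂P ≤ ∫ ω, (ρ n + Y n ω) ∂P := by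
          refine integral_mono (hVint n).norm ((integrable_const _).add (hint n)) fun ω => ?_
          simp only [hV, Real.norm_eq_abs]
          have := hpos n ω
          have := hρ_nonneg n
          rw [abs_le]
          constructor <;> linarith
      _ = ρ n + ∫ ω, Y n ω ∂P := by
          rw [integral_add (integrable_const _) (hint n)]
          simp
      _ ≤ _ := by
          have := hmean n
          have := hρ_le n
          linarith
  filter_upwards [hsub.exists_ae_tendsto_of_bdd hbdd] with ω ⟨l, hl⟩
  obtain ⟨B, hB⟩ := hl.bddBelow_range
  refine ⟨∑' k, r k - B, fun n => ?_⟩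
  have h1 : B ≤ V n ω := hB ⟨n, rfl⟩
  have h2 := hρ_le n
  simp only [hV] at h1
  linarith

/-- The right side involves `w` itself and not its truncation: where the truncation acts, `|w| > 1`
makes `w + w²` nonnegative. Taking conditional expectations therefore uses the centering of the
original errors, and the truncated ones need no recentering. -/
theorem exp_truncation_le (w : ℝ) : Real.exp (if |w| ≤ 1 then w else 0) ≤ 1 + w + w ^ 2 := by
  split_ifs with h
  · have := abs_le.mp (Real.abs_exp_sub_one_sub_id_le h)
    linarith [this.2]
  · rw [Real.exp_zero]
    rcases lt_or_ge w 0 with hw | hw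
    · rw [abs_of_neg hw] at h
      nlinarith
    · rw [abs_of_nonneg hw] at h
      nlinarith

theorem abs_truncation_le (w : ℝ) : |if |w| ≤ 1 then w else 0| ≤ 1 := by
  split_ifs with h
  · exact h
  · simp

theorem condExp_exp_truncation_le {Ω : Type*} {F mΩ : MeasurableSpace Ω}
    {P : Measure Ω} [IsProbabilityMeasure P] (hF : F ≤ mΩ)
    {ε : Ω → ℝ} {σ2 : ℝ} (hε : MemLp ε 2 P) (hmeas : Measurable ε) (h0 : P[ε | F] =ᵐ[P] 0)
    (h2 : P[fun ω => ε ω ^ 2 | F] ≤ᵐ[P] fun _ => σ2) (y : ℝ) :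
    P[fun ω => Real.exp (if |y * ε ω| ≤ 1 then y * ε ω else 0) | F]
      ≤ᵐ[P] fun _ => Real.exp (y ^ 2 * σ2) := by
  have hεint : Integrable ε P := hε.integrable (by norm_num)
  have hε2 : Integrable (fun ω => ε ω ^ 2) P := hε.integrable_sq
  have hmt : Measurable fun ω => (if |y * ε ω| ≤ 1 then y * ε ω else 0) :=
    Measurable.ite (measurableSet_le (by fun_prop) measurable_const) (by fun_prop)
      measurable_const
  have hint1 : Integrable (fun ω => Real.exp (if |y * ε ω| ≤ 1 then y * ε ω else 0)) P := by
    refine Integrable.of_bound hmt.exp.aestronglyMeasurable (Real.exp 1)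
      (Eventually.of_forall fun ω => ?_)
    rw [Real.norm_eq_abs, Real.abs_exp, Real.exp_le_exp]
    exact (le_abs_self _).trans (abs_truncation_le _)
  have hA : Integrable ((fun _ => (1 : ℝ)) + y • ε) P := (integrable_const _).add (hεint.smul y)
  have hB : Integrable (y ^ 2 • fun ω => ε ω ^ 2) P := hε2.smul _
  have hle : P[fun ω => Real.exp (if |y * ε ω| ≤ 1 then y * ε ω else 0) | F] ≤ᵐ[P]
      P[((fun _ => (1 : ℝ)) + y • ε) + y ^ 2 • fun ω => ε ω ^ 2 | F] := by
    refine condExp_mono hint1 (hA.add hB) (Eventually.of_forall fun ω => ?_)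
    have := exp_truncation_le (y * ε ω)
    simp only [Pi.add_apply, Pi.smul_apply, smul_eq_mul]
    rwa [mul_pow] at this
  have e1 := condExp_add (μ := P) hA hB F
  have e2 := condExp_add (μ := P) (integrable_const (1 : ℝ)) (hεint.smul y) F
  have e3 := condExp_smul (μ := P) y ε F
  have e4 := condExp_smul (μ := P) (y ^ 2) (fun ω => ε ω ^ 2) F
  rw [condExp_const hF] at e2
  filter_upwards [hle, e1, e2, e3, e4, h0, h2] with ω hle e1 e2 e3 e4 h0 h2
  refine hle.trans ?_
  rw [e1, Pi.add_apply, e2, Pi.add_apply, e3, e4]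
  simp only [Pi.smul_apply, smul_eq_mul, h0, Pi.zero_apply, mul_zero, add_zero]
  have := Real.add_one_le_exp (y ^ 2 * σ2)
  have := mul_le_mul_of_nonneg_left h2 (sq_nonneg y)
  linarith

/-- Here `exp (u b)` stands for the variance of the new error. Since `(1 - u) z + u b` is a convex
combination, convexity of `exp` turns this multiplicative growth into an additive error of order `u
exp b`; the sum over both signs is even, which permits the comparison through `|A|`. -/
theorem exp_contract_add_le {u t A b : ℝ} (hu0 : 0 ≤ u) (hu1 : u ≤ 1)
    (hA : |A| ≤ (1 - u) * |t|) :
    (Real.exp A + Real.exp (-A)) * Real.exp (u * b) ≤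
      (Real.exp t + Real.exp (-t)) + 2 * u * Real.exp b := by
  have hcosh : Real.exp A + Real.exp (-A) ≤
      Real.exp ((1 - u) * t) + Real.exp (-((1 - u) * t)) := by
    have : Real.cosh A ≤ Real.cosh ((1 - u) * t) := by
      rw [Real.cosh_le_cosh, abs_mul, abs_of_nonneg (by linarith : 0 ≤ 1 - u)]
      exact hA
    rw [Real.cosh_eq, Real.cosh_eq] at this
    linarith
  have conv : ∀ z : ℝ, Real.exp ((1 - u) * z) * Real.exp (u * b) ≤
      Real.exp z + u * Real.exp b := by
    intro z
    rw [← Real.exp_add]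
    have := convexOn_exp.2 (Set.mem_univ z) (Set.mem_univ b) (by linarith : 0 ≤ 1 - u) hu0
      (by ring)
    simp only [smul_eq_mul] at this
    nlinarith [Real.exp_pos z]
  calc (Real.exp A + Real.exp (-A)) * Real.exp (u * b)
      ≤ (Real.exp ((1 - u) * t) + Real.exp (-((1 - u) * t))) * Real.exp (u * b) := by gcongr
    _ ≤ _ := by
      have h1 := conv t
      have h2 := conv (-t)
      rw [mul_neg] at h2
      linarith

/-- The solution, started at `0`, of the linear recursion driven by the truncated errors. -/
noncomputable def truncatedRecursion {Ω : Type*} (ρ g y : ℕ → ℝ) (ε : ℕ → Ω → ℝ) : ℕ → Ω → ℝ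
  | 0, _ => 0
  | n + 1, ω => ρ n * truncatedRecursion ρ g y ε n ω +
      g n * (if |y n * ε n ω| ≤ 1 then ε n ω else 0)

/-- Iterated-logarithm type bound for a linear recursion driven by truncated martingale
differences. -/
theorem ae_truncatedRecursion_le {Ω : Type*} {mΩ : MeasurableSpace Ω}
    {P : Measure Ω} [IsProbabilityMeasure P] (F : Filtration ℕ mΩ) (ε : ℕ → Ω → ℝ)
    (ρ g x u ℓ : ℕ → ℝ) {σ2 C : ℝ} (hσ2 : 0 ≤ σ2) (hC : 0 ≤ C)
    (hmeas : ∀ n, Measurable[F (n + 1)] (ε n)) (hL2 : ∀ n, MemLp (ε n) 2 P)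
    (h0 : ∀ n, P[ε n | F n] =ᵐ[P] 0)
    (h2 : ∀ n, P[fun ω => ε n ω ^ 2 | F n] ≤ᵐ[P] fun _ => σ2)
    (hρ : ∀ n, 0 ≤ ρ n) (hu0 : ∀ n, 0 ≤ u n) (hu1 : ∀ n, u n ≤ 1) (hx : ∀ n, 0 < x n)
    (hcontr : ∀ n, x (n + 1) * ρ n ≤ (1 - u n) * x n)
    (hvar : ∀ n, (x (n + 1) * g n) ^ 2 ≤ C * u n * ℓ n)
    (hℓ : Monotone ℓ)
    (hsum : Summable fun n => u n * Real.exp (-(2 * ℓ n))) :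
    ∀ᵐ ω ∂P, ∃ K, ∀ n,
      x n * |truncatedRecursion ρ g (fun n => x (n + 1) * g n) ε n ω| ≤
        K + (σ2 * C + 2) * ℓ n := by
  set y : ℕ → ℝ := fun n => x (n + 1) * g n with hy
  set M : ℕ → Ω → ℝ := truncatedRecursion ρ g y ε with hM
  have hMsucc : ∀ n ω, x (n + 1) * M (n + 1) ω = x (n + 1) * ρ n * M n ω +
      (if |y n * ε n ω| ≤ 1 then y n * ε n ω else 0) := by
    intro n ω
    simp only [hM, truncatedRecursion]
    split_ifs
    · simp only [hy]; ring
    · ring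
  have hMmeas : ∀ n, Measurable[F n] (M n) := by
    intro n
    induction n with
    | zero => exact measurable_const
    | succ n ih =>
      have ht : Measurable fun t : ℝ => if |y n * t| ≤ 1 then t else 0 :=
        Measurable.ite (measurableSet_le (by fun_prop) measurable_const) measurable_id
          measurable_const
      have h1 : Measurable[F (n + 1)] (M n) := ih.mono (F.mono n.le_succ) le_rfl
      have h2 := hmeas n
      have h3 : Measurable[F (n + 1)] fun ω => (if |y n * ε n ω| ≤ 1 then ε n ω else 0) :=
        ht.comp h2
      exact (h1.const_mul _).add (h3.const_mul _)
  have hMbdd : ∀ n, ∃ B, ∀ ω, |x n * M n ω| ≤ B := by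
    intro n
    induction n with
    | zero => exact ⟨0, fun ω => by simp [hM, truncatedRecursion]⟩
    | succ n ih =>
      obtain ⟨B, hB⟩ := ih
      refine ⟨B + 1, fun ω => ?_⟩
      rw [hMsucc]
      refine (abs_add_le _ _).trans (add_le_add ?_ (abs_truncation_le _))
      refine le_trans ?_ (hB ω)
      rw [abs_mul, abs_mul (x n)]
      refine mul_le_mul_of_nonneg_right ?_ (abs_nonneg _)
      rw [abs_of_nonneg (mul_nonneg (hx _).le (hρ n)), abs_of_pos (hx n)]
      nlinarith [hcontr n, hu0 n, hx n]
  set Φ : ℕ → Ω → ℝ := fun n ω => Real.exp (x n * M n ω) + Real.exp (-(x n * M n ω)) with hΦ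
  -- The damping exceeds the growth `exp (σ2 C ℓ_n)` of the additive error by `exp (-2 ℓ_n)`, which
  -- leaves the summable remainder of `hsum`.
  set k : ℕ → ℝ := fun n => Real.exp (-((σ2 * C + 2) * ℓ n)) with hk
  have hexp_int : ∀ n (s : ℝ), (s = 1 ∨ s = -1) →
      Integrable (fun ω => Real.exp (s * (x n * M n ω))) P := by
    intro n s hs
    obtain ⟨B, hB⟩ := hMbdd n
    have hm : Measurable (M n) := (hMmeas n).mono (F.le n) le_rfl
    refine Integrable.of_bound (by fun_prop) (Real.exp B) (Eventually.of_forall fun ω => ?_)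
    rw [Real.norm_eq_abs, Real.abs_exp, Real.exp_le_exp]
    have := abs_le.mp (hB ω)
    rcases hs with rfl | rfl <;> linarith
  have hΦint : ∀ n, Integrable (Φ n) P := by
    intro n
    have h1 := (hexp_int n 1 (Or.inl rfl)).add (hexp_int n (-1) (Or.inr rfl))
    refine h1.congr (Eventually.of_forall fun ω => ?_)
    simp [hΦ]
  have hΦmeas : ∀ n, StronglyMeasurable[F n] (Φ n) := fun n =>
    (((hMmeas n).const_mul (x n)).exp.add ((hMmeas n).const_mul (x n)).neg.exp).stronglyMeasurable
  have hpull : ∀ n (s : ℝ), (s = 1 ∨ s = -1) →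
      P[fun ω => Real.exp (s * (x (n + 1) * M (n + 1) ω)) | F n] ≤ᵐ[P]
        fun ω => Real.exp (s * (x (n + 1) * ρ n * M n ω)) * Real.exp (y n ^ 2 * σ2) := by
    intro n s hs
    have hs2 : s ^ 2 = 1 := by rcases hs with rfl | rfl <;> norm_num
    have habs : |s| = 1 := by rcases hs with rfl | rfl <;> norm_num
    have hεm : Measurable (ε n) := (hmeas n).mono (F.le _) le_rfl
    have hb := condExp_exp_truncation_le (F.le n) (hL2 n) hεm (h0 n) (h2 n) (s * y n)
    have heq : (fun ω => Real.exp (s * (x (n + 1) * M (n + 1) ω))) =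
        (fun ω => Real.exp (s * (x (n + 1) * ρ n * M n ω))) *
          fun ω => Real.exp (if |s * y n * ε n ω| ≤ 1 then s * y n * ε n ω else 0) := by
      funext ω
      rw [Pi.mul_apply, ← Real.exp_add, hMsucc, mul_add]
      congr 2
      rw [mul_assoc s (y n), abs_mul s, habs, one_mul, mul_ite, mul_zero]
    have hint1 : Integrable (fun ω => Real.exp (s * (x (n + 1) * M (n + 1) ω))) P :=
      hexp_int (n + 1) s hs
    have hint2 : Integrable
        (fun ω => Real.exp (if |s * y n * ε n ω| ≤ 1 then s * y n * ε n ω else 0)) P := by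
      have hmt : Measurable fun ω =>
          (if |s * y n * ε n ω| ≤ 1 then s * y n * ε n ω else 0) :=
        Measurable.ite (measurableSet_le (by fun_prop) measurable_const) (by fun_prop)
          measurable_const
      refine Integrable.of_bound hmt.exp.aestronglyMeasurable (Real.exp 1)
        (Eventually.of_forall fun ω => ?_)
      rw [Real.norm_eq_abs, Real.abs_exp, Real.exp_le_exp]
      exact (le_abs_self _).trans (abs_truncation_le _)
    rw [heq] at hint1 ⊢
    have hp := condExp_mul_of_stronglyMeasurable_left (μ := P) (m := F n)
      ((((hMmeas n).const_mul (x (n + 1) * ρ n)).const_mul s).exp.stronglyMeasurable) hint1 hint2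
    filter_upwards [hp, hb] with ω hp hb
    rw [hp, Pi.mul_apply]
    refine mul_le_mul_of_nonneg_left ?_ (Real.exp_pos _).le
    rw [mul_pow, hs2, one_mul] at hb
    exact hb
  have hΦstep : ∀ n, P[Φ (n + 1) | F n] ≤ᵐ[P]
      fun ω => Φ n ω + 2 * u n * Real.exp (σ2 * C * ℓ n) := by
    intro n
    have hadd := condExp_add (μ := P) (hexp_int (n + 1) 1 (Or.inl rfl))
      (hexp_int (n + 1) (-1) (Or.inr rfl)) (F n)
    have heq : Φ (n + 1) = (fun ω => Real.exp (1 * (x (n + 1) * M (n + 1) ω))) +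
        fun ω => Real.exp (-1 * (x (n + 1) * M (n + 1) ω)) := by
      funext ω
      simp [hΦ]
    rw [← heq] at hadd
    filter_upwards [hadd, hpull n 1 (Or.inl rfl), hpull n (-1) (Or.inr rfl)] with ω e p q
    rw [e, Pi.add_apply]
    refine (add_le_add p q).trans ?_
    rw [← add_mul, one_mul, neg_one_mul]
    refine le_trans ?_ (exp_contract_add_le (A := x (n + 1) * ρ n * M n ω) (b := σ2 * C * ℓ n) (hu0 n) (hu1 n) ?_)
    · refine mul_le_mul_of_nonneg_left (Real.exp_le_exp.mpr ?_) (by positivity)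
      have := mul_le_mul_of_nonneg_right (hvar n) hσ2
      calc y n ^ 2 * σ2 ≤ C * u n * ℓ n * σ2 := this
        _ = _ := by ring
    · rw [abs_mul, abs_mul (x n), ← mul_assoc]
      refine mul_le_mul_of_nonneg_right ?_ (abs_nonneg _)
      rw [abs_of_nonneg (mul_nonneg (hx _).le (hρ n)), abs_of_pos (hx n)]
      exact (hcontr n)
  have hkanti : ∀ n, k (n + 1) ≤ k n := by
    intro n
    apply Real.exp_le_exp.mpr
    have := mul_le_mul_of_nonneg_left (hℓ n.le_succ) (by positivity : 0 ≤ σ2 * C + 2)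
    simpa using this
  have hfinal := ae_bddAbove_of_almost_supermartingale (P := P) F (fun n ω => k n * Φ n ω)
    (fun n => 2 * (u n * Real.exp (-(2 * ℓ n))))
    (fun n => stronglyMeasurable_const.mul (hΦmeas n)) (fun n => (hΦint n).const_mul _)
    (fun n ω => by positivity) (fun n => by have := hu0 n; positivity) (hsum.mul_left 2)
    (by
      intro n
      have e := condExp_smul (μ := P) (k (n + 1)) (Φ (n + 1)) (F n)
      have heq : k (n + 1) • Φ (n + 1) = fun ω => k (n + 1) * Φ (n + 1) ω := rfl
      rw [heq] at e
      filter_upwards [e, hΦstep n] with ω e h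
      rw [e, Pi.smul_apply, smul_eq_mul]
      have hk0 : 0 < k (n + 1) := Real.exp_pos _
      have hnn : 0 ≤ Φ n ω + 2 * u n * Real.exp (σ2 * C * ℓ n) := by
        have := hu0 n
        positivity
      calc k (n + 1) * (P[Φ (n + 1) | F n]) ω
          ≤ k (n + 1) * (Φ n ω + 2 * u n * Real.exp (σ2 * C * ℓ n)) :=
            mul_le_mul_of_nonneg_left h hk0.le
        _ ≤ k n * (Φ n ω + 2 * u n * Real.exp (σ2 * C * ℓ n)) :=
            mul_le_mul_of_nonneg_right (hkanti n) hnn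
        _ = k n * Φ n ω + 2 * (u n * (Real.exp (-((σ2 * C + 2) * ℓ n)) *
              Real.exp (σ2 * C * ℓ n))) := by simp only [hk]; ring
        _ = _ := by
            rw [← Real.exp_add]
            ring_nf)
  filter_upwards [hfinal] with ω ⟨K, hK⟩
  refine ⟨Real.log (max K 1), fun n => ?_⟩
  have hK1 : (0 : ℝ) < max K 1 := lt_max_of_lt_right one_pos
  have h1 : Real.exp (x n * |M n ω|) ≤ Φ n ω := by
    simp only [hΦ]
    rcases abs_cases (M n ω) with ⟨h, _⟩ | ⟨h, _⟩
    · rw [h]; linarith [Real.exp_pos (-(x n * M n ω))]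
    · rw [h, mul_neg]; linarith [Real.exp_pos (x n * M n ω)]
  have h2 : Real.exp (x n * |M n ω| - (σ2 * C + 2) * ℓ n) ≤ max K 1 := by
    refine le_trans ?_ ((hK n).trans (le_max_left _ _))
    rw [sub_eq_neg_add, Real.exp_add]
    exact mul_le_mul_of_nonneg_left h1 (Real.exp_pos _).le
  have h3 := (Real.le_log_iff_exp_le hK1).mpr h2
  linarith

/-- Almost surely, only finitely many of the variables exceed the truncation levels. -/
theorem ae_eventually_abs_le {Ω : Type*} {mΩ : MeasurableSpace Ω}
    {P : Measure Ω} (ε : ℕ → Ω → ℝ) (y : ℕ → ℝ)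
    {m : ℝ} {B : ℝ≥0∞} (hm : 0 < m) (hB : B ≠ ∞) (hmeas : ∀ n, AEStronglyMeasurable (ε n) P)
    (hmom : ∀ n, eLpNorm (ε n) (ENNReal.ofReal m) P ≤ B) (hy : ∀ n, 0 < y n)
    (hsum : Summable fun n => y n ^ m) :
    ∀ᵐ ω ∂P, ∀ᶠ n in atTop, |y n * ε n ω| ≤ 1 := by
  have hm0 : ENNReal.ofReal m ≠ 0 := by simpa using hm
  have hfin : ∑' n, P {ω | ENNReal.ofReal (y n)⁻¹ ≤ ‖ε n ω‖ₑ} ≠ ∞ := by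
    have hle : ∀ n, P {ω | ENNReal.ofReal (y n)⁻¹ ≤ ‖ε n ω‖ₑ} ≤
        ENNReal.ofReal (y n ^ m) * B ^ m := by
      intro n
      have h := meas_ge_le_mul_pow_eLpNorm_enorm P hm0 ENNReal.ofReal_ne_top (hmeas n)
        (ε := ENNReal.ofReal (y n)⁻¹) (by simpa using hy n)
        (fun h => absurd h ENNReal.ofReal_ne_top)
      rw [ENNReal.toReal_ofReal hm.le] at h
      refine h.trans (mul_le_mul' ?_ (ENNReal.rpow_le_rpow (hmom n) hm.le))
      rw [ENNReal.ofReal_inv_of_pos (hy n), inv_inv,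
        ENNReal.ofReal_rpow_of_pos (hy n)]
    refine ne_top_of_le_ne_top ?_ (ENNReal.tsum_le_tsum hle)
    rw [ENNReal.tsum_mul_right]
    refine ENNReal.mul_ne_top ?_ (ENNReal.rpow_ne_top_of_nonneg hm.le hB)
    rw [← ENNReal.ofReal_tsum_of_nonneg (fun n => Real.rpow_nonneg (hy n).le _) hsum]
    exact ENNReal.ofReal_ne_top
  filter_upwards [ae_eventually_notMem hfin] with ω hω
  filter_upwards [hω] with n hn
  simp only [not_le] at hn
  rw [← ofReal_norm, ENNReal.ofReal_lt_ofReal_iff (inv_pos.mpr (hy n)),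
    Real.norm_eq_abs] at hn
  rw [abs_mul, abs_of_pos (hy n)]
  calc y n * |ε n ω| ≤ y n * (y n)⁻¹ := mul_le_mul_of_nonneg_left hn.le (hy n).le
    _ = 1 := mul_inv_cancel₀ (hy n).ne'

/-- Iterated-logarithm type bound for a linear recursion driven by martingale differences with
bounded conditional second moments and bounded moments of order `m`. -/
theorem ae_eventually_mul_abs_le {Ω : Type*} {mΩ : MeasurableSpace Ω}
    {P : Measure Ω} [IsProbabilityMeasure P] (F : Filtration ℕ mΩ) (ε M : ℕ → Ω → ℝ)
    (ρ g x u ℓ : ℕ → ℝ) {σ2 C m : ℝ} {B : ℝ≥0∞} (hσ2 : 0 ≤ σ2) (hC : 0 ≤ C)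
    (hm : 0 < m) (hB : B ≠ ∞)
    (hmeas : ∀ n, Measurable[F (n + 1)] (ε n)) (hL2 : ∀ n, MemLp (ε n) 2 P)
    (h0 : ∀ n, P[ε n | F n] =ᵐ[P] 0)
    (h2 : ∀ n, P[fun ω => ε n ω ^ 2 | F n] ≤ᵐ[P] fun _ => σ2)
    (hmom : ∀ n, eLpNorm (ε n) (ENNReal.ofReal m) P ≤ B)
    (hM : ∀ n ω, M (n + 1) ω = ρ n * M n ω + g n * ε n ω)
    (hρ : ∀ n, 0 ≤ ρ n) (hu0 : ∀ n, 0 ≤ u n) (hu1 : ∀ n, u n ≤ 1) (hx : ∀ n, 0 < x n)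
    (hg : ∀ n, 0 < g n)
    (hcontr : ∀ n, x (n + 1) * ρ n ≤ (1 - u n) * x n)
    (hvar : ∀ n, (x (n + 1) * g n) ^ 2 ≤ C * u n * ℓ n)
    (hℓ : Monotone ℓ)
    (hsum : Summable fun n => u n * Real.exp (-(2 * ℓ n)))
    (hsum' : Summable fun n => (x (n + 1) * g n) ^ m) :
    ∀ᵐ ω ∂P, ∃ K, ∀ᶠ n in atTop, x n * |M n ω| ≤ K + (σ2 * C + 2) * ℓ n := by
  filter_upwards [ae_truncatedRecursion_le F ε ρ g x u ℓ hσ2 hC hmeas hL2 h0 h2 hρ hu0 hu1 hx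
    hcontr hvar hℓ hsum, ae_eventually_abs_le ε (fun n => x (n + 1) * g n) hm hB
      (fun n => (hL2 n).aestronglyMeasurable) hmom (fun n => mul_pos (hx _) (hg n)) hsum']
    with ω ⟨K, hK⟩ hev
  obtain ⟨N, hN⟩ := eventually_atTop.mp hev
  set M' := truncatedRecursion ρ g (fun n => x (n + 1) * g n) ε with hM'
  -- Once no truncation acts, the two solutions differ by a solution of the homogeneous recursion,
  -- which does not grow on the scale `x_n`. No measurability of `M` and no condition on its initial
  -- value is needed.
  have hD : ∀ n, N ≤ n → x n * |M n ω - M' n ω| ≤ x N * |M N ω - M' N ω| := by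
    intro n hn
    induction n, hn using Nat.le_induction with
    | base => exact le_rfl
    | succ n hn ih =>
      refine le_trans ?_ ih
      have h1 : M (n + 1) ω - M' (n + 1) ω = ρ n * (M n ω - M' n ω) := by
        rw [hM]
        simp only [hM', truncatedRecursion]
        rw [if_pos (hN n hn)]
        ring
      rw [h1, abs_mul, abs_of_nonneg (hρ n), ← mul_assoc]
      refine mul_le_mul_of_nonneg_right ?_ (abs_nonneg _)
      nlinarith [hcontr n, hu0 n, hx n]
  refine ⟨x N * |M N ω - M' N ω| + K, eventually_atTop.mpr ⟨N, fun n hn => ?_⟩⟩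
  have h1 : |M n ω| ≤ |M n ω - M' n ω| + |M' n ω| := by
    simpa using abs_add_le (M n ω - M' n ω) (M' n ω)
  have h2 := mul_le_mul_of_nonneg_left h1 (hx n).le
  have h3 := hD n hn
  have h4 := hK n
  rw [mul_add] at h2
  linarith

/-! ### Almost sure rate for noise with power-like step sizes -/

/-- `ε` is a martingale difference sequence (from index `1` on) with bounded conditional second
moments and bounded moments of order `m`. -/
structure IsNoise {Ω : Type*} {mΩ : MeasurableSpace Ω} (P : Measure Ω) (F : Filtration ℕ mΩ)
    (m : ℝ) (ε : ℕ → Ω → ℝ) : Prop where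
  measurable : ∀ n, 1 ≤ n → Measurable[F (n + 1)] (ε n)
  memLp_two : ∀ n, 1 ≤ n → MemLp (ε n) 2 P
  condExp_eq : ∀ n, 1 ≤ n → P[ε n | F n] =ᵐ[P] 0
  condExp_sq_le : ∃ σ2 : ℝ, 0 ≤ σ2 ∧
    ∀ n, 1 ≤ n → P[fun ω => ε n ω ^ 2 | F n] ≤ᵐ[P] fun _ => σ2
  moment : ∃ B : ℝ≥0∞, B ≠ ∞ ∧ ∀ n, 1 ≤ n → eLpNorm (ε n) (ENNReal.ofReal m) P ≤ B

/-- The filtration obtained by dropping the first `N` σ-fields. -/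
def shiftFiltration {Ω : Type*} {mΩ : MeasurableSpace Ω} (F : Filtration ℕ mΩ) (N : ℕ) :
    Filtration ℕ mΩ where
  seq n := F (n + N)
  mono' _ _ h := F.mono (by omega)
  le' n := F.le (n + N)

/-- Almost sure rate of a linear stochastic recursion with step sizes `γ_n` and errors
`ε_n / c_n`. -/
theorem IsNoise.ae_isBigO {Ω : Type*} {mΩ : MeasurableSpace Ω} {P : Measure Ω}
    [IsProbabilityMeasure P] {F : Filtration ℕ mΩ} {m : ℝ} {ε : ℕ → Ω → ℝ}
    (hε : IsNoise P F m ε) {γ c : ℕ → ℝ} {α q τ lam : ℝ} (hγ : IsStep γ α q) (hm : 2 < m)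
    (hα : 2 / m < α) (hα1 : α ≤ 1) (hc : HasRate τ c) (hlam : 0 < lam)
    (hq : α / 2 - τ < lam * q) {M : ℕ → Ω → ℝ}
    (hM : ∀ n, 1 ≤ n → ∀ ω, M (n + 1) ω = (1 - lam * γ n) * M n ω + γ n / c n * ε n ω) :
    ∀ᵐ ω ∂P, (fun n => M n ω) =O[atTop]
      fun n => √(γ n * Real.log (partialSum γ n)) / c n := by
  obtain ⟨σ2, hσ2, hsq⟩ := hε.condExp_sq_le
  obtain ⟨B, hB, hmom⟩ := hε.moment
  set y : ℕ → ℝ := fun n => √(γ n) * (c n)⁻¹ with hy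
  have hyrate : HasRate (α / 2 + -τ) y := hγ.rate.sqrt.mul hc.inv
  have hydom : Dominates lam γ y := hyrate.dominates hγ hlam (by linarith)
  obtain ⟨κ, hκ, hscale⟩ := hγ.eventually_scale_contract hydom
  set ℓ : ℕ → ℝ := fun n => Real.log (partialSum γ n) with hℓ
  -- With this scale the target rate `y_n √ℓ_n` equals `ℓ_n / x_n`, so a bound on `x_n |M_n|` linear
  -- in `ℓ_n` is what is wanted.
  set x : ℕ → ℝ := fun n => √(ℓ n) / y n with hx
  have hyratio : ∀ᶠ n in atTop, (y n / y (n + 1)) ^ 2 < 2 := by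
    have := hyrate.tendsto_ratio.pow 2
    rw [one_pow] at this
    exact this.eventually_lt_const one_lt_two
  obtain ⟨N, hN⟩ := eventually_atTop.mp
    ((((hscale.and hyratio).and (hc.1.and (hγ.tendsto_log.eventually_gt_atTop 0))).and
    ((hγ.eventually_mul_lt lam one_pos).and (hγ.eventually_mul_lt κ one_pos))).and
    ((eventually_ge_atTop 1).and (hγ.eventually_log_le one_pos)))
  have hy0 : ∀ n, N ≤ n → 0 < y n := fun n hn =>
    mul_pos (Real.sqrt_pos.mpr (hγ.pos n (hN n hn).2.1)) (inv_pos.mpr (hN n hn).1.1.2.1)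
  have hℓ0 : ∀ n, N ≤ n → 0 < ℓ n := fun n hn => (hN n hn).1.1.2.2
  have hx0 : ∀ n, N ≤ n → 0 < x n := fun n hn =>
    div_pos (Real.sqrt_pos.mpr (hℓ0 n hn)) (hy0 n hn)
  have hγ0 : ∀ n, N ≤ n → 0 < γ n := fun n hn => hγ.pos n (hN n hn).2.1
  have hc0 : ∀ n, N ≤ n → 0 < c n := fun n hn => (hN n hn).1.1.2.1
  have hlog2 : ∀ n, N ≤ n → γ n ≤ 1 → ℓ (n + 1) ≤ 2 * ℓ n := by
    intro n hn h1
    have h2 := (hN n hn).2.2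
    have h3 := hℓ0 n hn
    simp only [hℓ] at h3 ⊢
    nlinarith
  obtain ⟨N₁, hN₁⟩ := eventually_atTop.mp
    ((eventually_ge_atTop N).and (hγ.eventually_mul_lt 1 one_pos))
  have hNN : ∀ n, N₁ ≤ n → N ≤ n := fun n hn => (hN₁ n hn).1
  have hvar : ∀ n, N₁ ≤ n → (x (n + 1) * (γ n / c n)) ^ 2 ≤ 4 * (γ n * ℓ n) := by
    intro n hn
    have h0 := hNN n hn
    have h1 := hy0 n h0
    have h2 := hy0 (n + 1) (by omega)
    have h3 := hlog2 n h0 (by linarith [(hN₁ n hn).2])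
    have h4 := (hN n h0).1.1.1.2
    have h5 := hγ0 n h0
    have h6 : (γ n / c n) ^ 2 = γ n * y n ^ 2 := by
      simp only [hy]
      rw [mul_pow, Real.sq_sqrt h5.le]
      ring
    have h7 : 0 ≤ ℓ (n + 1) := (hℓ0 (n + 1) (by omega)).le
    have h8 := hℓ0 n h0
    calc (x (n + 1) * (γ n / c n)) ^ 2 = (ℓ (n + 1) * (y n / y (n + 1)) ^ 2) * γ n := by
          rw [mul_pow, h6]
          simp only [hx]
          rw [div_pow, Real.sq_sqrt h7]
          ring
      _ ≤ ((2 * ℓ n) * 2) * γ n := by gcongr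
      _ = _ := by ring
  -- Dropping the first `N₁` indices makes all eventual estimates hold everywhere. `C = 4 / κ` since
  -- `u_n = κ γ_n` and `hvar` has the constant 4: a factor 2 from `ℓ_{n+1} ≤ 2 ℓ_n` and a factor 2
  -- from the ratio of consecutive `y`.
  have hmain := ae_eventually_mul_abs_le (P := P) (shiftFiltration F N₁)
    (fun n => ε (n + N₁)) (fun n => M (n + N₁)) (fun n => 1 - lam * γ (n + N₁))
    (fun n => γ (n + N₁) / c (n + N₁)) (fun n => x (n + N₁)) (fun n => κ * γ (n + N₁))
    (fun n => ℓ (n + N₁)) (σ2 := σ2) (C := 4 / κ) (m := m) (B := B) hσ2 (by positivity)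
    (by linarith) hB
    (fun n => by
      have := hε.measurable (n + N₁) (hN _ (hNN _ (by omega))).2.1
      change Measurable[F (n + 1 + N₁)] _
      rwa [show n + 1 + N₁ = n + N₁ + 1 by ring])
    (fun n => hε.memLp_two _ (hN _ (hNN _ (by omega))).2.1)
    (fun n => hε.condExp_eq _ (hN _ (hNN _ (by omega))).2.1)
    (fun n => hsq _ (hN _ (hNN _ (by omega))).2.1)
    (fun n => hmom _ (hN _ (hNN _ (by omega))).2.1)
    (fun n ω => by
      have := hM (n + N₁) (hN _ (hNN _ (by omega))).2.1 ω
      rwa [show n + 1 + N₁ = n + N₁ + 1 by ring])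
    (fun n => by linarith [(hN (n + N₁) (hNN _ (by omega))).1.2.1])
    (fun n => mul_nonneg hκ.le (hγ0 _ (hNN _ (by omega))).le)
    (fun n => (hN (n + N₁) (hNN _ (by omega))).1.2.2.le)
    (fun n => hx0 _ (hNN _ (by omega)))
    (fun n => div_pos (hγ0 _ (hNN _ (by omega))) (hc0 _ (hNN _ (by omega))))
    (fun n => by
      have := (hN (n + N₁) (hNN _ (by omega))).1.1.1.1
      rwa [show n + 1 + N₁ = n + N₁ + 1 by ring])
    (fun n => by
      rw [show n + 1 + N₁ = n + N₁ + 1 by ring]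
      refine (hvar _ (by omega)).trans (le_of_eq ?_)
      field_simp)
    (monotone_nat_of_le_succ fun n => by
      have h1 := (hN (n + N₁) (hNN _ (by omega))).2.1
      exact Real.log_le_log (hγ.partialSum_pos h1) (hγ.partialSum_mono (by omega)))
    (by
      -- As `ℓ_n = log s_n`, the factor `exp (-2 ℓ_n)` is `1 / s_n²`.
      have := ((summable_nat_add_iff N₁).mpr hγ.summable_div_sq).mul_left κ
      refine this.congr fun n => ?_
      have h1 := hγ.partialSum_pos (hN (n + N₁) (hNN _ (by omega))).2.1
      simp only [hℓ]
      rw [Real.exp_neg, two_mul, Real.exp_add, Real.exp_log h1]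
      field_simp)
    (by
      have := ((summable_nat_add_iff N₁).mpr
        (hγ.summable_mul_log_rpow hm hα hα1)).mul_left ((4 : ℝ) ^ (m / 2))
      refine this.of_nonneg_of_le (fun n => ?_) fun n => ?_
      · have h1 := hx0 (n + 1 + N₁) (hNN _ (by omega))
        have h2 := hγ0 (n + N₁) (hNN _ (by omega))
        have h3 := hc0 (n + N₁) (hNN _ (by omega))
        positivity
      · have h1 := hx0 (n + 1 + N₁) (hNN _ (by omega))
        have h2 := hγ0 (n + N₁) (hNN _ (by omega))
        have h3 := hc0 (n + N₁) (hNN _ (by omega))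
        have h4 := hℓ0 (n + N₁) (hNN _ (by omega))
        have h5 := hvar (n + N₁) (by omega)
        rw [← Real.mul_rpow (by norm_num) (mul_nonneg h2.le h4.le)]
        rw [show n + 1 + N₁ = n + N₁ + 1 by ring] at h1 ⊢
        have h6 : (x (n + N₁ + 1) * (γ (n + N₁) / c (n + N₁))) ^ m =
            ((x (n + N₁ + 1) * (γ (n + N₁) / c (n + N₁))) ^ 2) ^ (m / 2) := by
          rw [← Real.rpow_natCast, ← Real.rpow_mul (by positivity)]
          congr 1
          push_cast
          ring
        rw [h6]
        exact Real.rpow_le_rpow (sq_nonneg _) h5 (by linarith))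
  filter_upwards [hmain] with ω ⟨K, hK⟩
  refine IsBigO.of_bound (|K| + (σ2 * (4 / κ) + 2)) ?_
  have hK' : ∀ᶠ n in atTop, x n * |M n ω| ≤ K + (σ2 * (4 / κ) + 2) * ℓ n := by
    have := (eventually_atTop.mp hK)
    obtain ⟨N₂, h⟩ := this
    refine eventually_atTop.mpr ⟨N₂ + N₁, fun n hn => ?_⟩
    have h1 := h (n - N₁) (by omega)
    rwa [Nat.sub_add_cancel (by omega)] at h1
  filter_upwards [hK', eventually_ge_atTop N, hγ.tendsto_log.eventually_ge_atTop 1]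
    with n h1 hn h2
  have h3 := hx0 n hn
  have h4 : x n * |M n ω| ≤ (|K| + (σ2 * (4 / κ) + 2)) * ℓ n := by
    refine h1.trans ?_
    rw [add_mul]
    have h5 : |K| * 1 ≤ |K| * ℓ n := mul_le_mul_of_nonneg_left h2 (abs_nonneg K)
    linarith [le_abs_self K]
  have h5 : √(γ n * Real.log (partialSum γ n)) / c n = ℓ n / x n := by
    have h6 := hℓ0 n hn
    have h7 := hγ0 n hn
    have h8 := hc0 n hn
    have h9 : √(ℓ n) * √(ℓ n) = ℓ n := Real.mul_self_sqrt h6.le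
    simp only [hx, hy]
    rw [Real.sqrt_mul h7.le]
    change √(γ n) * √(ℓ n) / c n = _
    have h10 : √(ℓ n) ≠ 0 := (Real.sqrt_pos.mpr h6).ne'
    rw [div_div_eq_mul_div, eq_div_iff h10]
    linear_combination (√(γ n) / c n) * h9
  rw [h5, Real.norm_eq_abs, Real.norm_of_nonneg (div_nonneg (hℓ0 n hn).le h3.le), ← mul_div_assoc,
    le_div_iff₀ h3]
  linarith

/-! ### From conditional laws to conditional moments -/

/-- Integrating the conditional probabilities over `A` identifies two measures at once, so integrals
of unbounded functions of `Z` over events of `F` follow without approximation by simple functions.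
-/
theorem map_restrict_eq_bind {Ω : Type*} {F mΩ : MeasurableSpace Ω} {P : Measure Ω}
    [IsProbabilityMeasure P] (hF : F ≤ mΩ) {d : ℕ} {κ : Kernel (E d) ℝ} [IsMarkovKernel κ]
    {Z : Ω → ℝ} (hZ : Measurable Z) {X : Ω → E d} (hX : Measurable X)
    (h : HasCondLaw P F Z fun ω => κ (X ω)) {A : Set Ω} (hA : MeasurableSet[F] A) :
    (P.restrict A).map Z = (P.restrict A).bind (κ.comap X hX) := by
  ext B hB
  rw [Measure.map_apply hZ hB, Measure.bind_apply hB (Kernel.aemeasurable _)]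
  have h1 : ∫ ω in A, (P⟦Z ⁻¹' B | F⟧) ω ∂P = ∫ ω in A, (Z ⁻¹' B).indicator (fun _ => (1 : ℝ)) ω ∂P :=
    setIntegral_condExp hF ((integrable_const 1).indicator (hZ hB)) hA
  rw [integral_congr_ae (ae_restrict_of_ae (h B hB)), integral_indicator_const _ (hZ hB),
    smul_eq_mul, mul_one] at h1
  have hmeas : Measurable fun ω => κ (X ω) B := (κ.measurable_coe hB).comp hX
  simp only [Measure.real] at h1
  rw [integral_toReal hmeas.aemeasurable (Eventually.of_forall fun ω => measure_lt_top _ _),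
    ENNReal.toReal_eq_toReal_iff' ?_ (measure_ne_top _ _)] at h1
  · rw [← h1]
    rfl
  · refine ne_top_of_le_ne_top (b := ∫⁻ _ in A, 1 ∂P) ?_ (lintegral_mono fun ω => prob_le_one)
    simp

theorem lintegral_comp_condLaw {Ω : Type*} {F mΩ : MeasurableSpace Ω} {P : Measure Ω}
    [IsProbabilityMeasure P] (hF : F ≤ mΩ) {d : ℕ} {κ : Kernel (E d) ℝ} [IsMarkovKernel κ]
    {Z : Ω → ℝ} (hZ : Measurable Z) {X : Ω → E d} (hX : Measurable X)
    (h : HasCondLaw P F Z fun ω => κ (X ω)) {g : ℝ → ℝ≥0∞} (hg : Measurable g) :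
    ∫⁻ ω, g (Z ω) ∂P = ∫⁻ ω, ∫⁻ z, g z ∂(κ (X ω)) ∂P := by
  have h1 := map_restrict_eq_bind hF hZ hX h (MeasurableSet.univ (m := F))
  rw [Measure.restrict_univ] at h1
  rw [← lintegral_map hg hZ, h1, Measure.lintegral_bind (Kernel.aemeasurable _) hg.aemeasurable]
  rfl

theorem lintegral_comp_condLaw_le {Ω : Type*} {F mΩ : MeasurableSpace Ω} {P : Measure Ω}
    [IsProbabilityMeasure P] (hF : F ≤ mΩ) {d : ℕ} {κ : Kernel (E d) ℝ} [IsMarkovKernel κ]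
    {Z : Ω → ℝ} (hZ : Measurable Z) {X : Ω → E d} (hX : Measurable X)
    (h : HasCondLaw P F Z fun ω => κ (X ω)) {g : ℝ → ℝ≥0∞} (hg : Measurable g) {C : ℝ≥0∞}
    (hC : ∀ x, ∫⁻ z, g z ∂(κ x) ≤ C) : ∫⁻ ω, g (Z ω) ∂P ≤ C := by
  rw [lintegral_comp_condLaw hF hZ hX h hg]
  refine (lintegral_mono fun ω => hC (X ω)).trans ?_
  simp

theorem integrable_comp_condLaw {Ω : Type*} {F mΩ : MeasurableSpace Ω} {P : Measure Ω}
    [IsProbabilityMeasure P] (hF : F ≤ mΩ) {d : ℕ} {κ : Kernel (E d) ℝ} [IsMarkovKernel κ]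
    {Z : Ω → ℝ} (hZ : Measurable Z) {X : Ω → E d} (hX : Measurable X)
    (h : HasCondLaw P F Z fun ω => κ (X ω)) {g : ℝ → ℝ} (hg : Measurable g) {C : ℝ≥0∞}
    (hC : ∀ x, ∫⁻ z, ‖g z‖ₑ ∂(κ x) ≤ C) (hC' : C ≠ ∞) : Integrable (fun ω => g (Z ω)) P :=
  ⟨(hg.comp hZ).aestronglyMeasurable,
    (lintegral_comp_condLaw_le hF hZ hX h hg.enorm hC).trans_lt hC'.lt_top⟩

/-- Conditional expectations are integrals with respect to the conditional law. -/
theorem condExp_comp_condLaw {Ω : Type*} {F mΩ : MeasurableSpace Ω} {P : Measure Ω}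
    [IsProbabilityMeasure P] (hF : F ≤ mΩ) {d : ℕ} {κ : Kernel (E d) ℝ} [IsMarkovKernel κ]
    {Z : Ω → ℝ} (hZ : Measurable Z) {X : Ω → E d} (hX : Measurable[F] X)
    (h : HasCondLaw P F Z fun ω => κ (X ω)) {g : ℝ → ℝ} (hg : Measurable g) {C : ℝ≥0∞}
    (hC : ∀ x, ∫⁻ z, ‖g z‖ₑ ∂(κ x) ≤ C) (hC' : C ≠ ∞) :
    P[fun ω => g (Z ω) | F] =ᵐ[P] fun ω => ∫ z, g z ∂(κ (X ω)) := by
  have hX' : Measurable X := hX.mono hF le_rfl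
  have hint := integrable_comp_condLaw hF hZ hX' h hg hC hC'
  have hsm : StronglyMeasurable[F] fun ω => ∫ z, g z ∂(κ (X ω)) :=
    (hg.stronglyMeasurable.integral_kernel (κ := κ)).comp_measurable hX
  have hbound : ∀ x, ‖∫ z, g z ∂(κ x)‖ ≤ C.toReal := by
    intro x
    refine (norm_integral_le_lintegral_norm _).trans ?_
    refine ENNReal.toReal_mono hC' ?_
    simpa only [ofReal_norm] using hC x
  have hint2 : Integrable (fun ω => ∫ z, g z ∂(κ (X ω))) P :=
    Integrable.of_bound (hsm.mono hF).aestronglyMeasurable C.toReal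
      (Eventually.of_forall fun ω => hbound _)
  refine (ae_eq_condExp_of_forall_setIntegral_eq hF hint (fun s _ _ => hint2.integrableOn) ?_
    hsm.aestronglyMeasurable).symm
  intro A hA _
  have h1 := map_restrict_eq_bind hF hZ hX' h hA
  have h2 : Integrable g ((P.restrict A).map Z) := by
    rw [integrable_map_measure hg.aestronglyMeasurable hZ.aemeasurable]
    exact hint.integrableOn
  rw [← integral_map (f := g) hZ.aemeasurable hg.aestronglyMeasurable, h1]
  rw [h1] at h2
  have h3 := Kernel.integral_comp (κ := Kernel.const Unit (P.restrict A)) (η := κ.comap X hX')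
    (a := ()) (f := g) (by rw [Kernel.comp_apply]; simpa using h2)
  rw [Kernel.comp_apply] at h3
  simp only [Kernel.const_apply, Kernel.comap_apply] at h3
  exact h3.symm

theorem measurable_regression {d : ℕ} (κ : Kernel (E d) ℝ) [IsMarkovKernel κ] :
    Measurable (regression κ) :=
  (stronglyMeasurable_id.integral_kernel (κ := κ)).measurable

theorem abs_le_one_add_rpow {m : ℝ} (hm : 1 ≤ m) (z : ℝ) : |z| ≤ 1 + |z| ^ m := by
  rcases le_total |z| 1 with h | h
  · linarith [Real.rpow_nonneg (abs_nonneg z) m]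
  · have := Real.rpow_le_rpow_of_exponent_le h hm
    rw [Real.rpow_one] at this
    linarith

theorem sq_le_one_add_rpow {m : ℝ} (hm : 2 ≤ m) (z : ℝ) : z ^ 2 ≤ 1 + |z| ^ m := by
  rw [← sq_abs]
  rcases le_total |z| 1 with h | h
  · nlinarith [Real.rpow_nonneg (abs_nonneg z) m, abs_nonneg z]
  · have := Real.rpow_le_rpow_of_exponent_le h hm
    rw [Real.rpow_ofNat] at this
    linarith

/-- Properties, uniform in the level `X`, of the error `Z - f(X)` of an observation. -/
theorem exists_error_bounds {d : ℕ} (κ : Kernel (E d) ℝ) [IsMarkovKernel κ] {m : ℝ} (hm : 2 < m)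
    (hmom : (⨆ x, ∫⁻ z, ENNReal.ofReal (|z| ^ m) ∂(κ x)) < ∞) :
    ∃ (σ2 : ℝ) (B : ℝ≥0∞), 0 ≤ σ2 ∧ B ≠ ∞ ∧
      ∀ {Ω : Type*} {F mΩ : MeasurableSpace Ω} {P : Measure Ω} [IsProbabilityMeasure P],
        F ≤ mΩ → ∀ {Z : Ω → ℝ}, Measurable Z → ∀ {X : Ω → E d}, Measurable[F] X →
        HasCondLaw P F Z (fun ω => κ (X ω)) →
        MemLp (fun ω => Z ω - regression κ (X ω)) 2 P ∧
        P[fun ω => Z ω - regression κ (X ω) | F] =ᵐ[P] 0 ∧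
        P[fun ω => (Z ω - regression κ (X ω)) ^ 2 | F] ≤ᵐ[P] (fun _ => σ2) ∧
        eLpNorm (fun ω => Z ω - regression κ (X ω)) (ENNReal.ofReal m) P ≤ B := by
  set C := ⨆ x, ∫⁻ z, ENNReal.ofReal (|z| ^ m) ∂(κ x) with hCdef
  have hC : ∀ x, ∫⁻ z, ENNReal.ofReal (|z| ^ m) ∂(κ x) ≤ C := fun x =>
    le_iSup (fun x => ∫⁻ z, ENNReal.ofReal (|z| ^ m) ∂(κ x)) x
  have hC1 : (1 : ℝ≥0∞) + C ≠ ∞ := by simpa using hmom.ne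
  have hbound : ∀ g : ℝ → ℝ, (∀ z, |g z| ≤ 1 + |z| ^ m) → ∀ x, ∫⁻ z, ‖g z‖ₑ ∂(κ x) ≤ 1 + C := by
    intro g hg x
    calc ∫⁻ z, ‖g z‖ₑ ∂(κ x) ≤ ∫⁻ z, (1 + ENNReal.ofReal (|z| ^ m)) ∂(κ x) := by
          refine lintegral_mono fun z => ?_
          rw [← ofReal_norm, Real.norm_eq_abs, ← ENNReal.ofReal_one,
            ← ENNReal.ofReal_add zero_le_one (by positivity)]
          exact ENNReal.ofReal_le_ofReal (hg z)
      _ = 1 + ∫⁻ z, ENNReal.ofReal (|z| ^ m) ∂(κ x) := by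
          rw [lintegral_add_left measurable_const]
          simp
      _ ≤ 1 + C := by gcongr; exact hC x
  have hb1 := hbound id fun z => abs_le_one_add_rpow (by linarith) z
  have hb2 := hbound (fun z => z ^ 2) fun z => by
    rw [abs_of_nonneg (sq_nonneg z)]
    exact sq_le_one_add_rpow hm.le z
  set K := (1 + C).toReal with hK
  have hK0 : 0 ≤ K := ENNReal.toReal_nonneg
  have hint_bound : ∀ g : ℝ → ℝ, (∀ x, ∫⁻ z, ‖g z‖ₑ ∂(κ x) ≤ 1 + C) →
      ∀ x, |∫ z, g z ∂(κ x)| ≤ K := by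
    intro g hg x
    rw [← Real.norm_eq_abs]
    refine (norm_integral_le_lintegral_norm _).trans (ENNReal.toReal_mono hC1 ?_)
    simpa only [ofReal_norm] using hg x
  have hf : ∀ x, |regression κ x| ≤ K := hint_bound id hb1
  have hm0 : 0 < m := by linarith
  have hm0' : ENNReal.ofReal m ≠ 0 := by simpa using hm0
  -- `K` bounds `|f|` and every second moment of `κ x`, and `(Z - f)² ≤ 2 Z² + 2 f²` gives the first
  -- constant. The second comes from Minkowski's inequality in `L^m`.
  refine ⟨2 * K + 2 * K ^ 2, C ^ (1 / m) + ENNReal.ofReal K, by positivity,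
    ENNReal.add_ne_top.mpr ⟨ENNReal.rpow_ne_top_of_nonneg (by positivity) hmom.ne,
      ENNReal.ofReal_ne_top⟩, ?_⟩
  intro Ω F mΩ P _ hF Z hZ X hX h
  have hX' : Measurable X := hX.mono hF le_rfl
  have hfX : Measurable[F] fun ω => regression κ (X ω) := (measurable_regression κ).comp hX
  have hfX' : Measurable fun ω => regression κ (X ω) := hfX.mono hF le_rfl
  have hWm : Measurable fun ω => Z ω - regression κ (X ω) := hZ.sub hfX'
  have hZnorm : eLpNorm Z (ENNReal.ofReal m) P ≤ C ^ (1 / m) := by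
    rw [eLpNorm_eq_lintegral_rpow_enorm_toReal hm0' ENNReal.ofReal_ne_top,
      ENNReal.toReal_ofReal hm0.le]
    refine ENNReal.rpow_le_rpow ?_ (by positivity)
    refine lintegral_comp_condLaw_le hF hZ hX' h (g := fun z => ‖z‖ₑ ^ m) (by fun_prop)
      fun x => ?_
    refine le_trans (le_of_eq (lintegral_congr fun z => ?_)) (hC x)
    rw [← ofReal_norm, Real.norm_eq_abs, ENNReal.ofReal_rpow_of_nonneg (abs_nonneg z) hm0.le]
  have hfnorm : eLpNorm (fun ω => regression κ (X ω)) (ENNReal.ofReal m) P ≤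
      ENNReal.ofReal K := by
    refine (eLpNorm_le_of_ae_bound (C := K) (Eventually.of_forall fun ω => hf _)).trans ?_
    simp
  have hWnorm : eLpNorm (fun ω => Z ω - regression κ (X ω)) (ENNReal.ofReal m) P ≤
      C ^ (1 / m) + ENNReal.ofReal K := by
    refine (eLpNorm_sub_le hZ.aestronglyMeasurable hfX'.aestronglyMeasurable ?_).trans
      (add_le_add hZnorm hfnorm)
    rw [ENNReal.one_le_ofReal]
    linarith
  have hfin : C ^ (1 / m) + ENNReal.ofReal K < ∞ :=
    (ENNReal.add_ne_top.mpr ⟨ENNReal.rpow_ne_top_of_nonneg (by positivity) hmom.ne,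
      ENNReal.ofReal_ne_top⟩).lt_top
  have h2m : (2 : ℝ≥0∞) ≤ ENNReal.ofReal m := by
    rw [← ENNReal.ofReal_ofNat]
    exact ENNReal.ofReal_le_ofReal hm.le
  have hmem : MemLp (fun ω => Z ω - regression κ (X ω)) 2 P :=
    MemLp.mono_exponent ⟨hWm.aestronglyMeasurable, hWnorm.trans_lt hfin⟩ h2m
  have hZint : Integrable Z P := integrable_comp_condLaw hF hZ hX' h measurable_id hb1 hC1
  have hZ2int : Integrable (fun ω => Z ω ^ 2) P :=
    integrable_comp_condLaw hF hZ hX' h (g := fun z => z ^ 2) (by fun_prop) hb2 hC1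
  have hfint : Integrable (fun ω => regression κ (X ω)) P :=
    Integrable.of_bound hfX'.aestronglyMeasurable K (Eventually.of_forall fun ω => hf _)
  refine ⟨hmem, ?_, ?_, hWnorm⟩
  · have e1 := condExp_sub (μ := P) hZint hfint F
    have e2 := condExp_comp_condLaw hF hZ hX h measurable_id hb1 hC1
    have e3 := condExp_of_stronglyMeasurable (μ := P) hF hfX.stronglyMeasurable hfint
    rw [e3] at e1
    filter_upwards [e1, e2] with ω e1 e2
    change (P[Z - fun ω => regression κ (X ω) | F]) ω = 0
    rw [e1, Pi.sub_apply]
    change (P[Z | F]) ω = regression κ (X ω) at e2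
    rw [e2, sub_self]
  · have hle : P[fun ω => (Z ω - regression κ (X ω)) ^ 2 | F] ≤ᵐ[P]
        P[(2 : ℝ) • (fun ω => Z ω ^ 2) + fun _ => 2 * K ^ 2 | F] := by
      refine condExp_mono hmem.integrable_sq ((hZ2int.smul (2 : ℝ)).add (integrable_const _))
        (Eventually.of_forall fun ω => ?_)
      have h1 := sq_le_sq' (abs_le.mp (hf (X ω))).1 (abs_le.mp (hf (X ω))).2
      simp only [Pi.add_apply, Pi.smul_apply, smul_eq_mul]
      nlinarith [sq_nonneg (Z ω + regression κ (X ω))]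
    have e1 := condExp_add (μ := P) (hZ2int.smul (2 : ℝ)) (integrable_const (2 * K ^ 2)) F
    have e2 := condExp_smul (μ := P) (2 : ℝ) (fun ω => Z ω ^ 2) F
    have e3 := condExp_comp_condLaw hF hZ hX h (g := fun z => z ^ 2) (by fun_prop) hb2 hC1
    rw [condExp_const hF] at e1
    filter_upwards [hle, e1, e2, e3] with ω hle e1 e2 e3
    refine hle.trans ?_
    rw [e1, Pi.add_apply, e2, Pi.smul_apply, e3, smul_eq_mul]
    have := (abs_le.mp (hint_bound (fun z => z ^ 2) hb2 (X ω))).2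
    linarith

/-! ### Adaptedness of a run and its error sequences -/

theorem measurable_noise_past {Ω : Type*} {d : ℕ} {D : Scheme d} (R : Run Ω d D) (κ : Kernel (E d) ℝ) (c : ℕ → ℝ) {n : ℕ}
    (hn : 1 ≤ n) (j : Fin d ⊕ Fin d ⊕ Fin D.delta) :
    Measurable[R.past κ c (n + 1)] (R.noise κ c n j) := by
  have h1 : MeasurableSpace.comap (R.noise κ c n j) inferInstance ≤ R.past κ c (n + 1) := by
    refine le_sup_of_le_right ?_
    refine le_iSup₂_of_le (f := fun q (_ : q ∈ Finset.Ico 1 (n + 1)) =>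
      ⨆ j : Fin d ⊕ Fin d ⊕ Fin D.delta,
        MeasurableSpace.comap (R.noise κ c q j) inferInstance) n
      (Finset.mem_Ico.mpr ⟨hn, n.lt_succ_self⟩) ?_
    exact le_iSup (fun j => MeasurableSpace.comap (R.noise κ c n j) inferInstance) j
  exact (comap_measurable _).mono h1 le_rfl

theorem past_mono {Ω : Type*} {d : ℕ} {D : Scheme d} (R : Run Ω d D) (κ : Kernel (E d) ℝ) (c : ℕ → ℝ) : Monotone (R.past κ c) := by
  intro n n' h
  refine sup_le_sup_left ?_ _
  exact biSup_mono fun q hq => Finset.Ico_subset_Ico_right h hq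

theorem measurable_theta_succ {Ω : Type*} {d : ℕ} {D : Scheme d} {F : MeasurableSpace Ω}
    {R : Run Ω d D} {a c : ℕ → ℝ} {n : ℕ}
    (hsucc : ∀ ω, R.theta (n + 1) ω = R.theta n ω + a n • R.Y c n ω)
    (hθ : Measurable[F] (R.theta n))
    (hY : ∀ i, Measurable[F] fun ω => R.Zplus n i ω - R.Zminus n i ω) :
    Measurable[F] (R.theta (n + 1)) := by
  have h1 : R.theta (n + 1) = fun ω => R.theta n ω + a n • R.Y c n ω :=
    funext hsucc
  have h2 : Measurable[F] (R.Y c n) := by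
    refine (WithLp.measurable_toLp 2 (Fin d → ℝ)).comp ?_
    rw [measurable_pi_iff]
    exact fun i => (hY i).const_mul _
  rw [h1]
  exact hθ.add (h2.const_smul (a n))

section Run

variable {Ω : Type*} [mΩ : MeasurableSpace Ω] {P : Measure Ω} {d : ℕ} {D : Scheme d}
  {κ : Kernel (E d) ℝ} {a c ã : ℕ → ℝ} {R : Run Ω d D}

theorem IsRun.measurable_theta (hR : IsRun P κ a c ã R) {n : ℕ} (hn : 1 ≤ n) :
    Measurable (R.theta n) := by
  induction n, hn using Nat.le_induction with
  | base => exact hR.measurable_theta_one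
  | succ n hn ih =>
    exact measurable_theta_succ (hR.theta_succ n hn) ih fun i =>
      (hR.measurable_plus n hn i).sub (hR.measurable_minus n hn i)

theorem IsRun.measurable_noise [IsMarkovKernel κ] (hR : IsRun P κ a c ã R) {n : ℕ} (hn : 1 ≤ n)
    (j : Fin d ⊕ Fin d ⊕ Fin D.delta) : Measurable (R.noise κ c n j) := by
  have hf := measurable_regression κ
  have hθ := hR.measurable_theta hn
  rcases j with i | i | k
  · exact (hR.measurable_plus n hn i).sub (hf.comp (hθ.add_const _))
  · exact (hR.measurable_minus n hn i).sub (hf.comp (hθ.sub_const _))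
  · cases D with
    | shared S hS => exact measurable_const
    | fresh δ hδ => exact (hR.measurable_extra trivial n hn k).sub (hf.comp hθ)

theorem IsRun.past_le [IsMarkovKernel κ] (hR : IsRun P κ a c ã R) (n : ℕ) :
    R.past κ c n ≤ mΩ := by
  refine sup_le hR.measurable_theta_one.comap_le ?_
  refine iSup₂_le fun q hq => iSup_le fun j => ?_
  exact (hR.measurable_noise (Finset.mem_Ico.mp hq).1 j).comap_le

/-- The past is generated by errors, not by observations. An observation is its error plus `f` at a
level determined by `θ_n`, so measurability propagates from `θ_n` to `θ_{n+1}`. -/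
theorem IsRun.measurable_theta_past [IsMarkovKernel κ] (hR : IsRun P κ a c ã R) {n : ℕ}
    (hn : 1 ≤ n) : Measurable[R.past κ c n] (R.theta n) := by
  induction n, hn using Nat.le_induction with
  | base => exact (comap_measurable _).mono le_sup_left le_rfl
  | succ n hn ih =>
    have hf := measurable_regression κ
    have ih' : Measurable[R.past κ c (n + 1)] (R.theta n) :=
      ih.mono (past_mono R κ c n.le_succ) le_rfl
    refine measurable_theta_succ (hR.theta_succ n hn) ih' fun i => ?_
    have h1 : (fun ω => R.Zplus n i ω - R.Zminus n i ω) = fun ω =>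
        (R.noise κ c n (Sum.inl i) ω + regression κ (R.theta n ω + c n • e i)) -
          (R.noise κ c n (Sum.inr (Sum.inl i)) ω + regression κ (R.theta n ω - c n • e i)) := by
      funext ω
      simp [Run.noise, Run.Wplus, Run.Wminus]
    rw [h1]
    exact ((measurable_noise_past R κ c hn _).add (hf.comp (ih'.add_const _))).sub
      ((measurable_noise_past R κ c hn _).add (hf.comp (ih'.sub_const _)))

/-- The filtration of the past σ-fields of a run. -/
noncomputable def IsRun.filtration [IsMarkovKernel κ] (hR : IsRun P κ a c ã R) : Filtration ℕ mΩ where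
  seq := R.past κ c
  mono' := past_mono R κ c
  le' := hR.past_le

theorem IsRun.isNoise [IsProbabilityMeasure P] [IsMarkovKernel κ] (hR : IsRun P κ a c ã R)
    {m : ℝ} (hm : 2 < m) (hmom : (⨆ x, ∫⁻ z, ENNReal.ofReal (|z| ^ m) ∂(κ x)) < ∞)
    (j : Fin d ⊕ Fin d ⊕ Fin D.delta) :
    IsNoise P hR.filtration m fun n => R.noise κ c n j := by
  obtain ⟨σ2, B, hσ2, hB, key⟩ := exists_error_bounds κ hm hmom
  have hall : ∀ n, 1 ≤ n → MemLp (R.noise κ c n j) 2 P ∧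
      P[R.noise κ c n j | R.past κ c n] =ᵐ[P] 0 ∧
      P[fun ω => R.noise κ c n j ω ^ 2 | R.past κ c n] ≤ᵐ[P] (fun _ => σ2) ∧
      eLpNorm (R.noise κ c n j) (ENNReal.ofReal m) P ≤ B := by
    intro n hn
    have hθ := hR.measurable_theta_past hn
    rcases j with i | i | k
    · exact key (hR.past_le n) (hR.measurable_plus n hn i) (hθ.add_const _) (hR.law_plus n hn i)
    · exact key (hR.past_le n) (hR.measurable_minus n hn i) (hθ.sub_const _)
        (hR.law_minus n hn i)
    · cases D with
      | shared S hS =>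
        have h0 : R.noise κ c n (Sum.inr (Sum.inr k)) = fun _ => 0 := rfl
        rw [h0]
        refine ⟨MemLp.zero, ?_, ?_, ?_⟩
        · exact (condExp_zero (μ := P)).eventuallyEq
        · have h1 : (fun _ : Ω => (0 : ℝ) ^ 2) = 0 := by funext; simp
          rw [h1, condExp_zero]
          exact Eventually.of_forall fun _ => hσ2
        · simp
      | fresh δ hδ =>
        exact key (hR.past_le n) (hR.measurable_extra trivial n hn k) hθ
          (hR.law_extra trivial n hn k)
  exact ⟨fun n hn => measurable_noise_past R κ c hn j, fun n hn => (hall n hn).1,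
    fun n hn => (hall n hn).2.1, ⟨σ2, hσ2, fun n hn => (hall n hn).2.2.1⟩,
    ⟨B, hB, fun n hn => (hall n hn).2.2.2⟩⟩

end Run

/-! ### Taylor estimates for the regression function near its maximizer -/

section Calculus

variable {d : ℕ} {f : E d → ℝ} {θ : E d} {L : ℝ}

theorem norm_e (i : Fin d) : ‖(e i : E d)‖ = 1 := by
  simp [e]

theorem sum_smul_e (x : E d) : ∑ i, x i • (e i : E d) = x := by
  ext j
  simp [e, Finset.sum_apply, Pi.single_apply]

theorem SmoothMax.quadratic_le (hf : SmoothMax f θ L) (x : E d) :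
    fderiv ℝ (fderiv ℝ f) θ x x ≤ -L * ‖x‖ ^ 2 := by
  set H := hessian f θ with hH
  have hHerm : H.IsHermitian := by
    have := hf.negDef.isHermitian.neg
    rwa [neg_neg] at this
  have hA : (-H - algebraMap ℝ (Matrix (Fin d) (Fin d) ℝ) L).IsHermitian := by
    refine hHerm.neg.sub ?_
    rw [Matrix.algebraMap_eq_diagonal]
    exact Matrix.isHermitian_diagonal _
  have hpsd : (-H - algebraMap ℝ (Matrix (Fin d) (Fin d) ℝ) L).PosSemidef := by
    rw [hA.posSemidef_iff_eigenvalues_nonneg]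
    intro i
    have hmem := hA.eigenvalues_mem_spectrum_real i
    set μ := hA.eigenvalues i
    -- An eigenvalue `μ` of `-H - L` yields the eigenvalue `-μ - L` of `H`; maximality of `-L` then
    -- forces `μ ≥ 0`.
    have h2 : -μ - L ∈ spectrum ℝ H := by
      rw [spectrum.mem_iff] at hmem ⊢
      intro hu
      apply hmem
      have h3 : algebraMap ℝ (Matrix (Fin d) (Fin d) ℝ) μ -
          (-H - algebraMap ℝ (Matrix (Fin d) (Fin d) ℝ) L) =
          -(algebraMap ℝ (Matrix (Fin d) (Fin d) ℝ) (-μ - L) - H) := by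
        rw [map_sub, map_neg]
        abel
      rw [h3]
      exact hu.neg
    have := hf.maxEigenvalue.2 h2
    simp only [Pi.zero_apply]
    linarith
  have h := hpsd.dotProduct_mulVec_nonneg (x : Fin d → ℝ)
  rw [Matrix.sub_mulVec, Matrix.neg_mulVec, dotProduct_sub, dotProduct_neg,
    Algebra.algebraMap_eq_smul_one, Matrix.smul_mulVec, Matrix.one_mulVec, dotProduct_smul] at h
  have h1 : star (x : Fin d → ℝ) ⬝ᵥ (x : Fin d → ℝ) = ‖x‖ ^ 2 := by
    rw [EuclideanSpace.real_norm_sq_eq]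
    simp [dotProduct, sq]
  have h2 : star (x : Fin d → ℝ) ⬝ᵥ H.mulVec (x : Fin d → ℝ) =
      fderiv ℝ (fderiv ℝ f) θ x x := by
    conv_rhs => rw [← sum_smul_e x]
    simp only [map_sum, map_smul, _root_.sum_apply, _root_.smul_apply,
      smul_eq_mul, dotProduct, Matrix.mulVec, hH, hessian, Matrix.of_apply, star_trivial,
      Finset.mul_sum]
    rw [Finset.sum_comm]
    refine Finset.sum_congr rfl fun i _ => Finset.sum_congr rfl fun j _ => ?_
    ring
  rw [h1, h2, smul_eq_mul] at h
  linarith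

/-- The gradient vanishes at `θ` and is differentiable there, hence is `O(‖x - θ‖)`; the mean value
inequality on the ball of radius `‖x - θ‖` supplies the second factor. -/
theorem isBigO_sub_of_isLocalMax (hf : ContDiffAt ℝ 2 f θ) (hmax : IsLocalMax f θ) :
    (fun x => f x - f θ) =O[𝓝 θ] fun x => ‖x - θ‖ ^ 2 := by
  have h0 : fderiv ℝ f θ = 0 := hmax.fderiv_eq_zero
  have h1 : ContDiffAt ℝ 1 (fderiv ℝ f) θ := hf.fderiv_right (by norm_num)
  have h2 := (h1.differentiableAt one_ne_zero).isBigO_sub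
  rw [h0] at h2
  simp only [sub_zero] at h2
  obtain ⟨C, hC0, hC⟩ := h2.exists_pos
  have h3 : ∀ᶠ x in 𝓝 θ, DifferentiableAt ℝ f x := by
    filter_upwards [hf.eventually (by simp)] with x hx using hx.differentiableAt (by norm_num)
  obtain ⟨r, hr, hball⟩ := Metric.eventually_nhds_iff_ball.mp (hC.bound.and h3)
  refine IsBigO.of_bound C ?_
  filter_upwards [Metric.ball_mem_nhds θ hr] with x hx
  have hsub : Metric.closedBall θ ‖x - θ‖ ⊆ Metric.ball θ r := by
    refine Metric.closedBall_subset_ball ?_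
    rwa [← dist_eq_norm]
  have := (convex_closedBall θ ‖x - θ‖).norm_image_sub_le_of_norm_fderiv_le (𝕜 := ℝ) (f := f)
    (C := C * ‖x - θ‖) (fun z hz => (hball z (hsub hz)).2) (fun z hz => by
      refine (hball z (hsub hz)).1.trans ?_
      gcongr
      rwa [← dist_eq_norm]) (Metric.mem_closedBall_self (norm_nonneg _))
      (Metric.mem_closedBall.mpr (dist_eq_norm x θ).le)
  rw [norm_pow, norm_norm]
  linarith

/-- Error of the symmetric difference quotient. -/
theorem exists_central_difference_le (hf : ContDiffAt ℝ 3 f θ) :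
    ∃ K, 0 ≤ K ∧ ∃ r > 0, ∀ x ∈ Metric.ball θ r, ∀ c, 0 < c → c < r → ∀ u : E d, ‖u‖ = 1 →
      |f (x + c • u) - f (x - c • u) - 2 * c * fderiv ℝ f x u| ≤ K * c ^ 3 := by
  have h1 : ContDiffAt ℝ 2 (fderiv ℝ f) θ := hf.fderiv_right (by norm_num)
  have h2 : ContDiffAt ℝ 1 (fderiv ℝ (fderiv ℝ f)) θ := h1.fderiv_right (by norm_num)
  obtain ⟨K, s, hs, hK⟩ := h2.exists_lipschitzOnWith
  have h3 : ∀ᶠ x in 𝓝 θ, DifferentiableAt ℝ f x ∧ DifferentiableAt ℝ (fderiv ℝ f) x := by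
    filter_upwards [hf.eventually (by simp), h1.eventually (by simp)] with x hx hx'
      using ⟨hx.differentiableAt (by norm_num), hx'.differentiableAt (by norm_num)⟩
  obtain ⟨ρ, hρ, hball⟩ := Metric.eventually_nhds_iff_ball.mp (h3.and hs)
  refine ⟨2 * K, by positivity, ρ / 2, half_pos hρ, ?_⟩
  intro x hx c hc0 hcr u hu
  have hin : ∀ t : ℝ, |t| ≤ c → x + t • u ∈ Metric.ball θ ρ := by
    intro t ht
    rw [Metric.mem_ball, dist_eq_norm] at hx ⊢
    calc ‖x + t • u - θ‖ = ‖(x - θ) + t • u‖ := by congr 1; abel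
      _ ≤ ‖x - θ‖ + ‖t • u‖ := norm_add_le _ _
      _ < ρ := by
        rw [norm_smul, hu, Real.norm_eq_abs]
        linarith
  have hder : ∀ t : ℝ, |t| ≤ c →
      HasDerivAt (fun t : ℝ => f (x + t • u)) (fderiv ℝ f (x + t • u) u) t := by
    intro t ht
    have hl : HasDerivAt (fun t : ℝ => x + t • u) u t := by
      simpa using ((hasDerivAt_id t).smul_const u).const_add x
    exact (hball _ (hin t ht)).1.1.hasFDerivAt.comp_hasDerivAt t hl
  have hder2 : ∀ t : ℝ, |t| ≤ c → HasDerivAt (fun t : ℝ => fderiv ℝ f (x + t • u) u)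
      (fderiv ℝ (fderiv ℝ f) (x + t • u) u u) t := by
    intro t ht
    have hl : HasDerivAt (fun t : ℝ => x + t • u) u t := by
      simpa using ((hasDerivAt_id t).smul_const u).const_add x
    have := (hball _ (hin t ht)).1.2.hasFDerivAt.comp_hasDerivAt t hl
    exact (ContinuousLinearMap.apply ℝ ℝ u).hasFDerivAt.comp_hasDerivAt t this
  have hneg : ∀ {g g' : ℝ → ℝ}, (∀ t : ℝ, |t| ≤ c → HasDerivAt g (g' t) t) →
      ∀ t : ℝ, |t| ≤ c → HasDerivAt (fun t => g (-t)) (-g' (-t)) t := by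
    intro g g' hg t ht
    have := (hg (-t) (by rwa [abs_neg])).comp t (hasDerivAt_neg t)
    simpa [Function.comp_def] using this
  have habs : ∀ t ∈ Set.Icc (0 : ℝ) c, |t| ≤ c := fun t ht => by
    rw [abs_of_nonneg ht.1]
    exact ht.2
  -- The function `t ↦ f (x + t u) - f (x - t u) - 2 t Df(x) u` vanishes at `0` with its derivative,
  -- and the Lipschitz property of `D²f` bounds its second derivative by `2 K c`. Two mean value
  -- steps give `2 K c³`; this is the first.
  have hchi : ∀ t ∈ Set.Icc (0 : ℝ) c,
      |fderiv ℝ f (x + t • u) u + fderiv ℝ f (x + (-t) • u) u - 2 * fderiv ℝ f x u| ≤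
        2 * K * c * c := by
    intro t ht
    have hd : ∀ t ∈ Set.Icc (0 : ℝ) c, HasDerivWithinAt (fun t : ℝ =>
        fderiv ℝ f (x + t • u) u + fderiv ℝ f (x + (-t) • u) u - 2 * fderiv ℝ f x u)
        (fderiv ℝ (fderiv ℝ f) (x + t • u) u u +
          -(fderiv ℝ (fderiv ℝ f) (x + (-t) • u) u u)) (Set.Icc 0 c) t := fun t ht =>
      (((hder2 t (habs t ht)).add (hneg hder2 t (habs t ht))).sub_const _).hasDerivWithinAt
    have hb : ∀ t ∈ Set.Ico (0 : ℝ) c, ‖fderiv ℝ (fderiv ℝ f) (x + t • u) u u +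
          -(fderiv ℝ (fderiv ℝ f) (x + (-t) • u) u u)‖ ≤ 2 * K * c := by
      intro t ht
      have ht' := habs t ⟨ht.1, ht.2.le⟩
      have h4 := hK.dist_le_mul _ (hball _ (hin t ht')).2 _
        (hball _ (hin (-t) (by rwa [abs_neg]))).2
      rw [dist_eq_norm, dist_eq_norm] at h4
      have h5 : x + t • u - (x + (-t) • u) = (2 * t) • u := by
        rw [neg_smul, two_mul, add_smul]
        abel
      rw [h5, norm_smul, hu, mul_one, Real.norm_eq_abs, abs_mul, abs_two] at h4
      rw [← sub_eq_add_neg, ← _root_.sub_apply, ← _root_.sub_apply]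
      refine ((ContinuousLinearMap.le_opNorm _ _).trans (mul_le_mul_of_nonneg_right
        (ContinuousLinearMap.le_opNorm _ _) (norm_nonneg _))).trans ?_
      rw [hu, mul_one, mul_one]
      refine h4.trans ?_
      calc (K : ℝ) * (2 * |t|) ≤ K * (2 * c) := by gcongr
        _ = 2 * K * c := by ring
    have := norm_image_sub_le_of_norm_deriv_le_segment' hd hb t ht
    simp only [neg_zero, zero_smul, add_zero, sub_zero, Real.norm_eq_abs] at this
    have h6 : fderiv ℝ f x u + fderiv ℝ f x u - 2 * fderiv ℝ f x u = 0 := by ring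
    rw [h6, sub_zero] at this
    refine this.trans ?_
    gcongr
    exact ht.2
  have hd : ∀ t ∈ Set.Icc (0 : ℝ) c, HasDerivWithinAt (fun t : ℝ =>
      f (x + t • u) - f (x + (-t) • u) - t * (2 * fderiv ℝ f x u))
      (fderiv ℝ f (x + t • u) u + fderiv ℝ f (x + (-t) • u) u - 2 * fderiv ℝ f x u)
        (Set.Icc 0 c) t := by
    intro t ht
    have h := ((hder t (habs t ht)).sub (hneg hder t (habs t ht))).sub
      ((hasDerivAt_id t).mul_const (2 * fderiv ℝ f x u))
    rw [sub_neg_eq_add, one_mul] at h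
    exact h.hasDerivWithinAt
  have := norm_image_sub_le_of_norm_deriv_le_segment' hd
    (fun t ht => hchi t ⟨ht.1, ht.2.le⟩) c ⟨hc0.le, le_rfl⟩
  simp only [neg_zero, zero_smul, add_zero, sub_self, zero_mul, sub_zero, Real.norm_eq_abs,
    neg_smul, ← sub_eq_add_neg] at this
  calc |f (x + c • u) - f (x - c • u) - 2 * c * fderiv ℝ f x u|
      = |f (x + c • u) - f (x - c • u) - c * (2 * fderiv ℝ f x u)| := by congr 1; ring
    _ ≤ _ := this
    _ = _ := by ring

theorem exists_difference_quotient_le (hf : ContDiffAt ℝ 3 f θ) (hmax : IsLocalMax f θ) {ε : ℝ}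
    (hε : 0 < ε) :
    ∃ K, 0 ≤ K ∧ ∃ r > 0, ∀ x ∈ Metric.ball θ r, ∀ c, 0 < c → c < r → ∀ i : Fin d,
      |1 / (2 * c) * (f (x + c • e i) - f (x - c • e i)) -
        fderiv ℝ (fderiv ℝ f) θ (x - θ) (e i)| ≤ ε * ‖x - θ‖ + K * c ^ 2 := by
  obtain ⟨K, hK, r, hr, h⟩ := exists_central_difference_le hf
  have h0 : fderiv ℝ f θ = 0 := hmax.fderiv_eq_zero
  have h1 : ContDiffAt ℝ 2 (fderiv ℝ f) θ := hf.fderiv_right (by norm_num)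
  have h2 := (h1.differentiableAt (by norm_num)).hasFDerivAt.isLittleO
  rw [h0] at h2
  obtain ⟨r', hr', h3⟩ := Metric.eventually_nhds_iff_ball.mp (h2.bound hε)
  refine ⟨K, hK, min r r', lt_min hr hr', fun x hx c hc0 hc i => ?_⟩
  have h4 := h x (Metric.ball_subset_ball (min_le_left _ _) hx) c hc0
    (hc.trans_le (min_le_left _ _)) (e i) (norm_e i)
  have h5 := h3 x (Metric.ball_subset_ball (min_le_right _ _) hx)
  rw [sub_zero] at h5
  have h6 := (ContinuousLinearMap.le_opNorm
    (fderiv ℝ f x - fderiv ℝ (fderiv ℝ f) θ (x - θ)) (e i)).trans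
      (mul_le_mul_of_nonneg_right h5 (norm_nonneg _))
  rw [norm_e, mul_one, _root_.sub_apply, Real.norm_eq_abs] at h6
  have h7 : |1 / (2 * c) * (f (x + c • e i) - f (x - c • e i)) - fderiv ℝ f x (e i)| ≤
      K * c ^ 2 := by
    have h8 : 1 / (2 * c) * (f (x + c • e i) - f (x - c • e i)) - fderiv ℝ f x (e i) =
        1 / (2 * c) * (f (x + c • e i) - f (x - c • e i) - 2 * c * fderiv ℝ f x (e i)) := by
      field_simp
    rw [h8, abs_mul, abs_of_pos (by positivity)]
    calc 1 / (2 * c) * |f (x + c • e i) - f (x - c • e i) - 2 * c * fderiv ℝ f x (e i)|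
        ≤ 1 / (2 * c) * (K * c ^ 3) := by gcongr
      _ = K * c ^ 2 / 2 := by field_simp
      _ ≤ K * c ^ 2 := half_le_self (by positivity)
  have := abs_sub_le (1 / (2 * c) * (f (x + c • e i) - f (x - c • e i))) (fderiv ℝ f x (e i))
    (fderiv ℝ (fderiv ℝ f) θ (x - θ) (e i))
  linarith

end Calculus

/-! ### Rate of convergence of the maximizer estimate -/

/-- A perturbed linear recursion whose drift is contracting at rate `L` inherits the rate of the
solution `M` of a scalar linear recursion with the same noise. -/
theorem isBigO_of_linear_drift {V : Type*} [NormedAddCommGroup V] [InnerProductSpace ℝ V]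
    (H : V →L[ℝ] V) {L lam α q : ℝ} (hH : ∀ x, inner ℝ (H x) x ≤ -L * ‖x‖ ^ 2) (hlam : lam < L)
    (hlam0 : 0 < lam) {a v c : ℕ → ℝ} (ha : IsStep a α q) (hv : Dominates lam a v)
    {Δ M G N : ℕ → V}
    (hΔ : ∀ᶠ n in atTop, Δ (n + 1) = Δ n + a n • G n + N n)
    (hM : ∀ᶠ n in atTop, M (n + 1) = (1 - lam * a n) • M n + N n)
    (hG : ∀ ε > 0, ∃ K, 0 ≤ K ∧ ∀ᶠ n in atTop, ‖G n - H (Δ n)‖ ≤ ε * ‖Δ n‖ + K * c n ^ 2)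
    (hMv : M =O[atTop] v) (hcv : (fun n => c n ^ 2) =O[atTop] v) : Δ =O[atTop] v := by
  obtain ⟨K, hK0, hK⟩ := hG ((L - lam) / 2) (by linarith)
  obtain ⟨C₁, hC₁, hMb⟩ := hMv.exists_pos
  obtain ⟨C₂, hC₂, hcb⟩ := hcv.exists_pos
  set ε := (L - lam) / 2 with hε
  have hε0 : 0 < ε := by rw [hε]; linarith
  set C := (ε + ‖H‖ + lam) * C₁ + K * C₂ with hC
  have hCpos : 0 ≤ C := by positivity
  have hR : (fun n => ‖Δ n - M n‖) =O[atTop] v := by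
    refine isBigO_of_contraction ha hv hCpos (fun n => norm_nonneg _) ?_
    filter_upwards [hΔ, hM, hK, hMb.bound, hcb.bound, hv.1, ha.eventually_pos,
      ha.eventually_mul_lt (‖H‖ ^ 2) hε0, ha.eventually_mul_lt (lam + ε) one_pos]
      with n h1 h2 h3 h4 h5 h6 h7 h8 h9
    rw [Real.norm_of_nonneg h6.le] at h4 h5
    rw [Real.norm_of_nonneg (sq_nonneg _)] at h5
    set r := Δ n - M n with hr
    have e1 : Δ (n + 1) - M (n + 1) =
        (r + a n • H r) + a n • ((G n - H (Δ n)) + (H (M n) + lam • M n)) := by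
      rw [h1, h2, hr, map_sub]
      module
    -- With `L = lam + 2 ε`, the square of the left side is at most `(1 - 2 a lam - 3 a ε) ‖r‖²`,
    -- the term `a² ‖H r‖²` costing `a ε ‖r‖²`. The surplus `ε` in the claimed rate later absorbs
    -- the error `ε ‖r‖` of the drift.
    have e2 : ‖r + a n • H r‖ ≤ (1 - (lam + ε) * a n) * ‖r‖ := by
      have h0 : 0 ≤ (1 - (lam + ε) * a n) * ‖r‖ := mul_nonneg (by linarith) (norm_nonneg _)
      refine le_of_sq_le_sq ?_ h0
      rw [norm_add_sq_real, inner_smul_right, norm_smul, Real.norm_of_nonneg h7.le,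
        real_inner_comm]
      have i1 := mul_le_mul_of_nonneg_left (hH r) h7.le
      have i2 : ‖H r‖ ^ 2 ≤ ‖H‖ ^ 2 * ‖r‖ ^ 2 := by
        rw [← mul_pow]
        exact pow_le_pow_left₀ (norm_nonneg _) (H.le_opNorm r) 2
      have i3 : (a n) ^ 2 * ‖H r‖ ^ 2 ≤ a n * ε * ‖r‖ ^ 2 := by
        calc (a n) ^ 2 * ‖H r‖ ^ 2 ≤ (a n) ^ 2 * (‖H‖ ^ 2 * ‖r‖ ^ 2) := by gcongr
          _ = a n * (‖H‖ ^ 2 * a n) * ‖r‖ ^ 2 := by ring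
          _ ≤ a n * ε * ‖r‖ ^ 2 := by gcongr
      have i4 : 0 ≤ a n * ε * ‖r‖ ^ 2 := by positivity
      have hL : L = lam + 2 * ε := by rw [hε]; ring
      have i5 : 0 ≤ ((lam + ε) * a n * ‖r‖) ^ 2 := sq_nonneg _
      rw [hL] at i1
      nlinarith
    have e3 : ‖G n - H (Δ n)‖ ≤ ε * (‖r‖ + ‖M n‖) + K * c n ^ 2 := by
      refine h3.trans ?_
      have : ‖Δ n‖ ≤ ‖r‖ + ‖M n‖ := by
        have := norm_add_le r (M n)
        rwa [hr, sub_add_cancel] at this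
      gcongr
    have e4 : ‖H (M n) + lam • M n‖ ≤ (‖H‖ + lam) * ‖M n‖ := by
      refine (norm_add_le _ _).trans ?_
      rw [norm_smul, Real.norm_of_nonneg hlam0.le, add_mul]
      gcongr
      exact H.le_opNorm _
    rw [e1]
    calc ‖(r + a n • H r) + a n • ((G n - H (Δ n)) + (H (M n) + lam • M n))‖
        ≤ ‖r + a n • H r‖ + a n * (‖G n - H (Δ n)‖ + ‖H (M n) + lam • M n‖) := by
          refine (norm_add_le _ _).trans ?_
          rw [norm_smul, Real.norm_of_nonneg h7.le]
          gcongr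
          exact norm_add_le _ _
      _ ≤ (1 - (lam + ε) * a n) * ‖r‖ +
          a n * ((ε * (‖r‖ + ‖M n‖) + K * c n ^ 2) + (‖H‖ + lam) * ‖M n‖) := by gcongr
      _ = (1 - lam * a n) * ‖r‖ + a n * ((ε + ‖H‖ + lam) * ‖M n‖ + K * c n ^ 2) := by ring
      _ ≤ (1 - lam * a n) * ‖r‖ +
          a n * ((ε + ‖H‖ + lam) * (C₁ * v n) + K * (C₂ * v n)) := by gcongr
      _ = _ := by rw [hC]; ring
  have := (hR.of_norm_left).add hMv
  simpa using this

/-- The solution, started at `0`, of the linear recursion `M_{n+1} = ρ_n M_n + g_n ε_n`. -/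
noncomputable def linearRecursion {Ω : Type*} (ρ g : ℕ → ℝ) (ε : ℕ → Ω → ℝ) : ℕ → Ω → ℝ
  | 0, _ => 0
  | n + 1, ω => ρ n * linearRecursion ρ g ε n ω + g n * ε n ω

/-- The Hessian of `f` at `θ` as a linear operator. -/
noncomputable def hessianOperator {d : ℕ} (f : E d → ℝ) (θ : E d) : E d →L[ℝ] E d :=
  ∑ i, ((fderiv ℝ (fderiv ℝ f) θ).flip (e i)).smulRight (e i)

theorem hessianOperator_apply {d : ℕ} (f : E d → ℝ) (θ x : E d) :
    hessianOperator f θ x = ∑ i, fderiv ℝ (fderiv ℝ f) θ x (e i) • (e i : E d) := by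
  simp [hessianOperator]

theorem SmoothMax.inner_hessianOperator_le {d : ℕ} {f : E d → ℝ} {θ : E d} {L : ℝ}
    (hf : SmoothMax f θ L) (x : E d) : inner ℝ (hessianOperator f θ x) x ≤ -L * ‖x‖ ^ 2 := by
  refine le_trans (le_of_eq ?_) (hf.quadratic_le x)
  rw [hessianOperator_apply, sum_inner]
  have h := map_sum (fderiv ℝ (fderiv ℝ f) θ x) (fun i => x i • (e i : E d)) Finset.univ
  rw [sum_smul_e] at h
  rw [h]
  refine Finset.sum_congr rfl fun i _ => ?_
  rw [real_inner_smul_left, map_smul, smul_eq_mul, mul_comm]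
  congr 1
  simp [e, EuclideanSpace.inner_single_left]

theorem norm_sum_smul_e_le {d : ℕ} (t : Fin d → ℝ) : ‖∑ i, t i • (e i : E d)‖ ≤ ∑ i, |t i| := by
  refine (norm_sum_le _ _).trans (le_of_eq (Finset.sum_congr rfl fun i _ => ?_))
  rw [norm_smul, norm_e, mul_one, Real.norm_eq_abs]

/-- Almost sure rate of convergence of the Kiefer-Wolfowitz algorithm. -/
theorem IsRun.ae_theta_isBigO {Ω : Type*} [MeasurableSpace Ω] {P : Measure Ω}
    [IsProbabilityMeasure P] {d : ℕ} {κ : Kernel (E d) ℝ} [IsMarkovKernel κ] {θ : E d}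
    {D : Scheme d} {a c ã : ℕ → ℝ} {R : Run Ω d D} (hR : IsRun P κ a c ã R) {L m α τ q lam : ℝ}
    (hmax : IsLocalMax (regression κ) θ)
    (hconv : ∀ᵐ ω ∂P, Tendsto (fun n => R.theta n ω) atTop (𝓝 θ))
    (hsmooth : SmoothMax (regression κ) θ L) (hm : 2 < m)
    (hmom : (⨆ x, ∫⁻ z, ENNReal.ofReal (|z| ^ m) ∂(κ x)) < ∞)
    (ha : IsStep a α q) (hα : 2 / m < α) (hα1 : α ≤ 1) (hc : HasRate τ c)
    (hc0 : Tendsto c atTop (𝓝 0)) (hlam0 : 0 < lam) (hlam : lam < L)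
    (hq1 : α / 2 - τ < lam * q) (hq2 : 2 * τ < lam * q) :
    ∀ᵐ ω ∂P, (fun n => R.theta n ω - θ) =O[atTop]
      fun n => √(a n) * (c n)⁻¹ * √(Real.log (partialSum a n)) + c n ^ 2 := by
  set f := regression κ with hf
  set W := R.noise κ c with hW
  -- One scalar recursion per error, run at the rate `lam` common to all coordinates;
  -- `isBigO_of_linear_drift` later compares it with the true drift. The values at index `0` are
  -- arbitrary and only alter the state at index `1`.
  set S : Fin d ⊕ Fin d ⊕ Fin D.delta → ℕ → Ω → ℝ := fun j =>
    linearRecursion (fun n => 1 - lam * a n) (fun n => a n / c n) (fun n => W n j) with hS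
  have hSj : ∀ j, ∀ᵐ ω ∂P, (fun n => S j n ω) =O[atTop]
      fun n => √(a n * Real.log (partialSum a n)) / c n := fun j =>
    (hR.isNoise hm hmom j).ae_isBigO ha hm hα hα1 hc hlam0 hq1 fun n _ ω => rfl
  have hyrate : HasRate (α / 2 + -τ) fun n => √(a n) * (c n)⁻¹ := ha.rate.sqrt.mul hc.inv
  have hhdom : Dominates lam a fun n =>
      √(a n) * (c n)⁻¹ * √(Real.log (partialSum a n)) :=
    ha.dominates_mul_sqrt_log (hyrate.dominates ha hlam0 (by linarith))
  have hc2rate : HasRate (2 * τ) fun n => c n ^ 2 := by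
    have := hc.mul hc
    simp only [← sq, ← two_mul] at this
    exact this
  have hc2dom : Dominates lam a fun n => c n ^ 2 := hc2rate.dominates ha hlam0 hq2
  set v : ℕ → ℝ := fun n => √(a n) * (c n)⁻¹ * √(Real.log (partialSum a n)) + c n ^ 2 with hv
  have hvdom : Dominates lam a v := hhdom.add ha hc2dom
  have hSv : (fun n => √(a n * Real.log (partialSum a n)) / c n) =O[atTop] v := by
    refine IsBigO.of_bound 1 ?_
    filter_upwards [ha.eventually_pos, hhdom.1, hc2dom.1] with n h1 h2 h3
    have h4 : √(a n * Real.log (partialSum a n)) / c n =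
        √(a n) * (c n)⁻¹ * √(Real.log (partialSum a n)) := by
      rw [Real.sqrt_mul h1.le]
      ring
    rw [h4, Real.norm_of_nonneg h2.le, one_mul, Real.norm_of_nonneg (add_pos h2 h3).le]
    linarith
  have hcv : (fun n => c n ^ 2) =O[atTop] v := by
    refine IsBigO.of_bound 1 ?_
    filter_upwards [hhdom.1, hc2dom.1] with n h2 h3
    rw [Real.norm_of_nonneg h3.le, one_mul, Real.norm_of_nonneg (add_pos h2 h3).le]
    linarith
  filter_upwards [hconv, ae_all_iff.mpr hSj] with ω hω hSω
  refine isBigO_of_linear_drift (hessianOperator f θ) (L := L) (lam := lam)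
    hsmooth.inner_hessianOperator_le hlam hlam0 ha hvdom (c := c)
    (M := fun n => ∑ i, ((S (Sum.inl i) n ω - S (Sum.inr (Sum.inl i)) n ω) / 2) • (e i : E d))
    (G := fun n => ∑ i, (1 / (2 * c n) * (f (R.theta n ω + c n • e i) -
      f (R.theta n ω - c n • e i))) • (e i : E d))
    (N := fun n => ∑ i, (a n / c n * (W n (Sum.inl i) ω - W n (Sum.inr (Sum.inl i)) ω) / 2) •
      (e i : E d)) ?_ ?_ ?_ ?_ hcv
  · filter_upwards [eventually_ge_atTop 1] with n hn
    rw [hR.theta_succ n hn, ← sum_smul_e (R.Y c n ω), Finset.smul_sum, Finset.smul_sum,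
      add_assoc, ← Finset.sum_add_distrib, add_sub_right_comm]
    congr 1
    refine Finset.sum_congr rfl fun i _ => ?_
    rw [smul_smul, smul_smul, ← add_smul]
    congr 1
    simp only [hW, Run.noise, Run.Wplus, Run.Wminus, Run.Y, Sum.elim_inl, Sum.elim_inr]
    ring
  · refine Eventually.of_forall fun n => ?_
    rw [Finset.smul_sum, ← Finset.sum_add_distrib]
    refine Finset.sum_congr rfl fun i _ => ?_
    rw [smul_smul, ← add_smul]
    congr 1
    simp only [hS, linearRecursion]
    ring
  · intro ε hε
    -- Dividing by `d + 1` keeps the sum of the `d` coordinate errors below `ε ‖θ_n - θ‖`, also for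
    -- `d = 0`.
    obtain ⟨K, hK, r, hr, h⟩ := exists_difference_quotient_le hsmooth.contDiffAt hmax
      (ε := ε / (d + 1)) (by positivity)
    refine ⟨d * K, by positivity, ?_⟩
    filter_upwards [hω.eventually (Metric.ball_mem_nhds θ hr), hc.1,
      hc0.eventually_lt_const hr] with n h1 h2 h3
    rw [hessianOperator_apply, ← Finset.sum_sub_distrib]
    simp only [← sub_smul]
    refine (norm_sum_smul_e_le _).trans ?_
    refine (Finset.sum_le_sum fun i _ => h _ h1 _ h2 h3 i).trans ?_
    rw [Finset.sum_const, Finset.card_univ, Fintype.card_fin, nsmul_eq_mul, mul_add]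
    have h4 : (d : ℝ) * (ε / (d + 1) * ‖R.theta n ω - θ‖) ≤ ε * ‖R.theta n ω - θ‖ := by
      rw [← mul_assoc]
      refine mul_le_mul_of_nonneg_right ?_ (norm_nonneg _)
      rw [← mul_div_assoc, div_le_iff₀ (by positivity)]
      nlinarith
    linarith
  · refine IsBigO.trans ?_ hSv
    refine IsBigO.fun_sum fun i _ => ?_
    have h1 : (fun n => (S (Sum.inl i) n ω - S (Sum.inr (Sum.inl i)) n ω) / 2) =O[atTop]
        fun n => √(a n * Real.log (partialSum a n)) / c n := by
      have := ((hSω (Sum.inl i)).sub (hSω (Sum.inr (Sum.inl i)))).const_mul_left (1 / 2)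
      refine this.congr_left fun n => ?_
      ring
    refine IsBigO.trans (IsBigO.of_bound 1 (Eventually.of_forall fun n => ?_)) h1
    rw [norm_smul, norm_e, mul_one, one_mul]

/-! ### Rate of convergence of the estimate of the maximum -/

/-- Decomposition of the averaged observation into a linear combination of the errors and a
bias. -/
theorem exists_Ytilde_decomposition {Ω : Type*} {d : ℕ} {D : Scheme d} (R : Run Ω d D)
    (κ : Kernel (E d) ℝ) {c : ℕ → ℝ} {θ : E d} (hc0 : Tendsto c atTop (𝓝 0))
    (hf : (fun x => regression κ x - regression κ θ) =O[𝓝 θ] fun x => ‖x - θ‖ ^ 2) :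
    ∃ (w : Fin d ⊕ Fin d ⊕ Fin D.delta → ℝ) (B : ℕ → Ω → ℝ),
      (∀ n ω, R.Ytilde n ω = ∑ j, w j * R.noise κ c n j ω + B n ω) ∧
      ∀ ω, Tendsto (fun n => R.theta n ω) atTop (𝓝 θ) →
        (fun n => B n ω - regression κ θ) =O[atTop]
          fun n => ‖R.theta n ω - θ‖ ^ 2 + D.b c n ^ 2 := by
  cases D with
  | shared S hS =>
    have hcard : (S.card : ℝ) ≠ 0 := by
      exact_mod_cast hS.card_ne_zero
    refine ⟨Sum.elim (fun i => if i ∈ S then 1 / (2 * S.card : ℝ) else 0)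
      (Sum.elim (fun i => if i ∈ S then 1 / (2 * S.card : ℝ) else 0) 0),
      fun n ω => 1 / (2 * S.card : ℝ) * ∑ i ∈ S, (regression κ (R.theta n ω + c n • e i) +
        regression κ (R.theta n ω - c n • e i)), fun n ω => ?_, fun ω hω => ?_⟩
    · simp only [Fintype.sum_sum_type, Sum.elim_inl, Sum.elim_inr, Pi.zero_apply, zero_mul,
        Finset.sum_const_zero, add_zero, ite_mul, Finset.sum_ite_mem, Finset.univ_inter,
        Run.noise, Run.Wplus, Run.Wminus, Run.Ytilde, ← Finset.mul_sum,
        Finset.sum_add_distrib, Finset.sum_sub_distrib]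
      ring
    · have key : ∀ (s : ℝ), |s| = 1 → ∀ i : Fin d,
          (fun n => regression κ (R.theta n ω + (s * c n) • e i) - regression κ θ) =O[atTop]
            fun n => ‖R.theta n ω - θ‖ ^ 2 + c n ^ 2 := by
        intro s hs i
        have ht : Tendsto (fun n => R.theta n ω + (s * c n) • (e i : E d)) atTop (𝓝 θ) := by
          have h1 : Tendsto (fun n => s * c n) atTop (𝓝 0) := by
            simpa using hc0.const_mul s
          simpa using hω.add (h1.smul_const (e i : E d))
        refine (hf.comp_tendsto ht).trans (IsBigO.of_bound 2 (Eventually.of_forall fun n => ?_))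
        simp only [Function.comp_apply]
        rw [Real.norm_of_nonneg (by positivity), Real.norm_of_nonneg (by positivity)]
        have h2 : ‖R.theta n ω + (s * c n) • (e i : E d) - θ‖ ≤ ‖R.theta n ω - θ‖ + |c n| := by
          rw [add_sub_right_comm]
          refine (norm_add_le _ _).trans ?_
          rw [norm_smul, norm_e, mul_one, Real.norm_eq_abs, abs_mul, hs, one_mul]
        have h3 := pow_le_pow_left₀ (norm_nonneg _) h2 2
        nlinarith [sq_nonneg (‖R.theta n ω - θ‖ - |c n|), sq_abs (c n)]
      have h1 : (fun n => 1 / (2 * S.card : ℝ) * ∑ i ∈ S,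
          ((regression κ (R.theta n ω + (1 * c n) • e i) - regression κ θ) +
          (regression κ (R.theta n ω + (-1 * c n) • e i) - regression κ θ))) =O[atTop]
            fun n => ‖R.theta n ω - θ‖ ^ 2 + c n ^ 2 :=
        (IsBigO.fun_sum fun i _ => (key 1 (by simp) i).add (key (-1) (by simp) i)).const_mul_left _
      refine h1.congr_left fun n => ?_
      simp only [one_mul, neg_mul, neg_smul, ← sub_eq_add_neg]
      rw [Finset.sum_add_distrib, Finset.sum_sub_distrib, Finset.sum_sub_distrib,
        Finset.sum_add_distrib, Finset.sum_const, nsmul_eq_mul]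
      field_simp
      ring
  | fresh δ hδ =>
    have hδ0 : (δ : ℝ) ≠ 0 := by
      have : δ ≠ 0 := by omega
      exact_mod_cast this
    refine ⟨Sum.elim 0 (Sum.elim 0 fun _ => 1 / (δ : ℝ)), fun n ω => regression κ (R.theta n ω),
      fun n ω => ?_, fun ω hω => ?_⟩
    · simp only [Fintype.sum_sum_type, Sum.elim_inl, Sum.elim_inr, Pi.zero_apply, zero_mul,
        Finset.sum_const_zero, zero_add, Run.noise, Run.U, Run.Ytilde, ← Finset.mul_sum,
        Finset.sum_sub_distrib, Finset.sum_const, Finset.card_univ, nsmul_eq_mul]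
      change _ = 1 / (δ : ℝ) * (_ - (Fintype.card (Fin δ) : ℝ) * _) + _
      rw [Fintype.card_fin]
      field_simp
      rw [sub_add_cancel]
      rfl
    · refine (hf.comp_tendsto hω).congr_right fun n => ?_
      simp [Scheme.b]

/-- Almost sure rate of convergence of `μ_n`, for a bias of order `v`. -/
theorem IsRun.ae_mu_isBigO {Ω : Type*} [MeasurableSpace Ω] {P : Measure Ω}
    [IsProbabilityMeasure P] {d : ℕ} {κ : Kernel (E d) ℝ} [IsMarkovKernel κ] {θ : E d}
    {D : Scheme d} {a c ã : ℕ → ℝ} {R : Run Ω d D} (hR : IsRun P κ a c ã R) {m α q : ℝ}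
    (hf : (fun x => regression κ x - regression κ θ) =O[𝓝 θ] fun x => ‖x - θ‖ ^ 2)
    (hconv : ∀ᵐ ω ∂P, Tendsto (fun n => R.theta n ω) atTop (𝓝 θ)) (hm : 2 < m)
    (hmom : (⨆ x, ∫⁻ z, ENNReal.ofReal (|z| ^ m) ∂(κ x)) < ∞)
    (hã : IsStep ã α q) (hα : 2 / m < α) (hα1 : α ≤ 1) (hq : α / 2 < q)
    (hc0 : Tendsto c atTop (𝓝 0)) {v : ℕ → ℝ} (hv : Dominates 1 ã v)
    (hbias : ∀ᵐ ω ∂P, (fun n => ‖R.theta n ω - θ‖ ^ 2 + D.b c n ^ 2) =O[atTop] v)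
    {w : ℕ → ℝ} (hvw : v =O[atTop] w)
    (hw : (fun n => √(ã n * Real.log (partialSum ã n))) =O[atTop] w) :
    ∀ᵐ ω ∂P, (fun n => |R.mu n ω - regression κ θ|) =O[atTop] w := by
  obtain ⟨p, B, hY, hB⟩ := exists_Ytilde_decomposition R κ hc0 hf
  -- The same noise estimate applies with contraction rate 1 and the constant sequence 1 in place of
  -- `c_n`, which turns its condition into `α / 2 < q`.
  set N : Fin d ⊕ Fin d ⊕ Fin D.delta → ℕ → Ω → ℝ := fun j =>
    linearRecursion (fun n => 1 - 1 * ã n) (fun n => ã n / 1) (fun n => R.noise κ c n j) with hN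
  have h1rate : HasRate 0 fun _ : ℕ => (1 : ℝ) :=
    ⟨Eventually.of_forall fun _ => one_pos, by simp⟩
  have hNj : ∀ j, ∀ᵐ ω ∂P, (fun n => N j n ω) =O[atTop]
      fun n => √(ã n * Real.log (partialSum ã n)) / 1 := fun j =>
    (hR.isNoise hm hmom j).ae_isBigO hã hm hα hα1 h1rate one_pos (by linarith)
      fun n _ ω => rfl
  filter_upwards [hconv, hbias, ae_all_iff.mpr hNj] with ω hω hbω hNω
  obtain ⟨C, hC, hCB⟩ := ((hB ω hω).trans hbω).exists_pos
  have hsum : (fun n => ∑ j, p j * N j n ω) =O[atTop] w := by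
    refine IsBigO.trans (IsBigO.fun_sum fun j _ => (hNω j).const_mul_left (p j)) ?_
    simpa only [div_one] using hw
  have hrest : (fun n => |R.mu n ω - regression κ θ - ∑ j, p j * N j n ω|) =O[atTop] v := by
    refine isBigO_of_contraction hã hv hC.le (fun n => abs_nonneg _) ?_
    filter_upwards [hCB.bound, hv.1, hã.eventually_pos, hã.eventually_mul_lt 1 one_pos,
      eventually_ge_atTop 1] with n h1 h2 h3 h4 h5
    rw [Real.norm_of_nonneg h2.le, Real.norm_eq_abs] at h1
    have e1 : R.mu (n + 1) ω - regression κ θ - ∑ j, p j * N j (n + 1) ω =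
        (1 - 1 * ã n) * (R.mu n ω - regression κ θ - ∑ j, p j * N j n ω) +
          ã n * (B n ω - regression κ θ) := by
      have e2 : ∑ j, p j * N j (n + 1) ω =
          (1 - 1 * ã n) * ∑ j, p j * N j n ω + ã n * ∑ j, p j * R.noise κ c n j ω := by
        rw [Finset.mul_sum, Finset.mul_sum, ← Finset.sum_add_distrib]
        refine Finset.sum_congr rfl fun j _ => ?_
        simp only [hN, linearRecursion]
        ring
      rw [e2, hR.mu_succ n h5, hY]
      ring
    rw [e1]
    refine (abs_add_le _ _).trans ?_
    rw [abs_mul, abs_mul, abs_of_nonneg (by linarith : 0 ≤ 1 - 1 * ã n), abs_of_pos h3]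
    have := mul_le_mul_of_nonneg_left h1 h3.le
    linarith
  have := ((hrest.trans hvw).of_abs_left).add hsum
  refine IsBigO.abs_left ?_
  simpa using this

/-! ### Consequences of the step size conditions and conclusion -/

theorem LimAbove.exists_le {u : ℕ → ℝ} {x : ℝ} (h : LimAbove u x) :
    ∃ q, x < q ∧ ∀ᶠ n in atTop, q ≤ u n := by
  obtain ⟨l, hl, ht⟩ := h
  obtain ⟨q, hq1, hq2⟩ := EReal.lt_iff_exists_real_btwn.mp hl
  refine ⟨q, by exact_mod_cast hq1, ?_⟩
  filter_upwards [ht.eventually_const_lt hq2] with n hn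
  exact_mod_cast hn.le

/-- If `ã_n / c_n⁴` stays bounded while `n ã_n` stays away from `0`, then `c_n` cannot decrease
faster than `n ^ (-1/4)`. -/
theorem HasRate.le_quarter {c ã : ℕ → ℝ} {τ q q' : ℝ} (hc : HasRate τ c) (hq : 0 < q)
    (hq' : 0 < q') (hã : ∀ᶠ n in atTop, 0 < ã n) (h1 : ∀ᶠ n : ℕ in atTop, q ≤ n * ã n)
    (h2 : ∀ᶠ n in atTop, q' ≤ (ã n)⁻¹ * c n ^ 4) : τ ≤ 1 / 4 := by
  by_contra! hτ
  -- If `τ > 1 / 4`, then `n c_n⁴ = O(n ^ (1 - 4 b))` tends to `0`, whereas both lower bounds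
  -- together keep it above `q q'`. The cap at 1 meets the exponent range of
  -- `HasRate.exists_le_rpow`.
  obtain ⟨b, hb1, hb2⟩ := exists_between (lt_min hτ (by norm_num : (1 / 4 : ℝ) < 1))
  obtain ⟨C, hC, hcb⟩ := hc.exists_le_rpow (by linarith : (0 : ℝ) ≤ b)
    (hb2.trans_le (min_le_right _ _)).le (hb2.trans_le (min_le_left _ _))
  have hlim : Tendsto (fun n : ℕ => C ^ 4 * (n : ℝ) ^ (-(4 * b - 1))) atTop (𝓝 0) := by
    have := ((tendsto_rpow_neg_atTop (by linarith : 0 < 4 * b - 1)).comp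
      tendsto_natCast_atTop_atTop).const_mul (C ^ 4)
    simpa using this
  obtain ⟨n, h1, h2, h3, h4, h5, h6, h7⟩ := (h1.and (h2.and (hcb.and (hã.and (hc.1.and
    ((eventually_gt_atTop 0).and (hlim.eventually_lt_const (mul_pos hq hq')))))))).exists
  have hn : (0 : ℝ) < n := by exact_mod_cast h6
  rw [← div_eq_inv_mul, le_div_iff₀ h4] at h2
  have h8 : c n ^ 4 ≤ C ^ 4 * (n : ℝ) ^ (-(4 * b)) := by
    calc c n ^ 4 ≤ (C * (n : ℝ) ^ (-b)) ^ 4 := by gcongr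
      _ = _ := by
        rw [mul_pow, ← Real.rpow_natCast ((n : ℝ) ^ (-b)), ← Real.rpow_mul hn.le]
        congr 2
        push_cast
        ring
  have h9 : C ^ 4 * (n : ℝ) ^ (-(4 * b - 1)) = n * (C ^ 4 * (n : ℝ) ^ (-(4 * b))) := by
    rw [neg_sub, sub_eq_neg_add, Real.rpow_add hn, Real.rpow_one]
    ring
  rw [h9] at h7
  have h10 : q * q' ≤ n * (q' * ã n) := by nlinarith
  have h11 : n * (q' * ã n) ≤ n * (C ^ 4 * (n : ℝ) ^ (-(4 * b))) := by
    exact mul_le_mul_of_nonneg_left (h2.trans h8) hn.le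
  linarith

end KieferWolfowitz

open KieferWolfowitz in
theorem proposition2 {Ω : Type*} [MeasurableSpace Ω] (P : Measure Ω) [IsProbabilityMeasure P]
    {d : ℕ} (hd : 1 ≤ d) (κ : Kernel (E d) ℝ) [IsMarkovKernel κ] (θ : E d)
    (hmax : ∀ x, x ≠ θ → regression κ x < regression κ θ)
    (D : Scheme d) (a c ã : ℕ → ℝ) (R : Run Ω d D) (hR : IsRun P κ a c ã R)
    (L σ m α τ αt : ℝ)
    (hconv : ∀ᵐ ω ∂P, Tendsto (fun n => R.theta n ω) atTop (𝓝 θ))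
    (hsmooth : SmoothMax (regression κ) θ L)
    (hnoise : NoiseAssumptions P κ c R σ m)
    (hstep : StepAssumptions D a c ã L m α τ αt) :
    (Tendsto (fun n => (ã n)⁻¹ * D.b c n ^ 4) atTop (𝓝 0) →
      ∀ᵐ ω ∂P, (fun n => |R.mu n ω - regression κ θ|) =O[atTop]
        fun n => √(ã n * Real.log (partialSum ã n))) ∧
    (LimAbove (fun n => (ã n)⁻¹ * D.b c n ^ 4) 0 →
      ∀ᵐ ω ∂P, (fun n => |R.mu n ω - regression κ θ|) =O[atTop]
        fun n => √(ã n * Real.log (partialSum ã n)) + D.b c n ^ 2) := by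
  have hlocal : IsLocalMax (regression κ) θ := Eventually.of_forall fun x => by
    rcases eq_or_ne x θ with rfl | h
    exacts [le_rfl, (hmax x h).le]
  have hf2 := isBigO_sub_of_isLocalMax (hsmooth.contDiffAt.of_le (by norm_num)) hlocal
  have hL := hsmooth.pos
  have hm := hnoise.two_lt
  have hα1 := hstep.alpha_mem.2
  have hα2 : 2 / m < α := (le_max_right _ _).trans_lt hstep.alpha_mem.1
  have hαt1 := hstep.alphat_mem.2
  have hαt2 : 2 / m < αt := (le_max_right _ _).trans_lt hstep.alphat_mem.1
  obtain ⟨hτ0, hτα⟩ := hstep.tau_mem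
  obtain ⟨q, hq, hqa⟩ := hstep.lim_a.exists_le
  obtain ⟨qt, hqt, hqat⟩ := hstep.lim_at.exists_le
  have hq1 : (1 - 2 * τ) / (2 * L) < q := (le_max_left _ _).trans_lt hq
  have hq2 : 2 * τ / L < q := (le_max_right _ _).trans_lt hq
  have hq0 : 0 < q := lt_trans (by positivity) hq2
  have ha : IsStep a α q := ⟨hstep.a_mem.1, hstep.a_tendsto, hstep.a_mem.hasRate, hq0, hqa⟩
  have hã : IsStep ã αt qt :=
    ⟨hstep.at_mem.1, hstep.at_tendsto, hstep.at_mem.hasRate, by linarith, hqat⟩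
  have hc : HasRate τ c := hstep.c_mem.hasRate
  rw [div_lt_iff₀ (by positivity)] at hq1
  rw [div_lt_iff₀ hL] at hq2
  -- (A4)(iii) leaves room for `lam < L` with `(1 - 2 τ) / 2 < lam q` and `2 τ < lam q`. As `α ≤ 1`,
  -- the first also gives `α / 2 - τ < lam q`.
  obtain ⟨lam, hlam1, hlam2⟩ := exists_between
    (max_lt ((div_lt_iff₀ hq0).mpr (by linarith : (1 - 2 * τ) / 2 < L * q))
      ((div_lt_iff₀ hq0).mpr (by linarith : 2 * τ < L * q)))
  have hl1 := (le_max_left _ _).trans_lt hlam1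
  have hl2 := (le_max_right _ _).trans_lt hlam1
  have hlam0 : 0 < lam := lt_trans (by positivity) hl2
  rw [div_lt_iff₀ hq0] at hl1 hl2
  have hθ := hR.ae_theta_isBigO hlocal hconv hsmooth hm hnoise.moment ha hα2 hα1 hc
    hstep.c_tendsto hlam0 hlam2 (by linarith) hl2
  have hθ2 : ∀ᵐ ω ∂P, (fun n => ‖R.theta n ω - θ‖ ^ 2) =O[atTop]
      fun n => a n * Real.log (partialSum a n) / c n ^ 2 + c n ^ 4 := by
    filter_upwards [hθ] with ω hω
    refine (hω.norm_left.pow 2).trans (IsBigO.of_bound 2 ?_)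
    filter_upwards [ha.eventually_pos, hc.1, ha.tendsto_log.eventually_gt_atTop 0]
      with n h1 h2 h3
    rw [Real.norm_of_nonneg (by positivity), Real.norm_of_nonneg (by positivity)]
    have h4 : (√(a n) * (c n)⁻¹ * √(Real.log (partialSum a n))) ^ 2 =
        a n * Real.log (partialSum a n) / c n ^ 2 := by
      rw [mul_pow, mul_pow, Real.sq_sqrt h1.le, Real.sq_sqrt h3.le]
      ring
    rw [← h4]
    nlinarith [sq_nonneg (√(a n) * (c n)⁻¹ * √(Real.log (partialSum a n)) - c n ^ 2)]
  constructor
  · intro hcase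
    obtain ⟨hlim1, hlim2⟩ := hstep.case_zero hcase
    have hdom : Dominates 1 ã fun n => √(ã n) * √(Real.log (partialSum ã n)) :=
      hã.dominates_mul_sqrt_log (hã.rate.sqrt.dominates hã one_pos (by linarith))
    refine hR.ae_mu_isBigO hf2 hconv hm hnoise.moment hã hαt2 hαt1 (by linarith)
      hstep.c_tendsto hdom ?_ ?_ (isBigO_refl _ _)
    · filter_upwards [hθ2] with ω hω
      have hsqrt : (fun n => √(ã n)) =O[atTop]
          fun n => √(ã n) * √(Real.log (partialSum ã n)) := by
        refine IsBigO.of_bound 1 ?_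
        filter_upwards [hã.tendsto_log.eventually_ge_atTop 1] with n h1
        rw [Real.norm_of_nonneg (by positivity), Real.norm_of_nonneg (by positivity), one_mul]
        exact le_mul_of_one_le_right (Real.sqrt_nonneg _) (Real.one_le_sqrt.mpr h1)
      -- Every part of the bias is `O(√ã_n)`: `a_n log s_n / c_n²` directly, `c_n⁴` because `c_n⁸ ≤
      -- ã_n`, and `b_n²` because `b_n⁴ ≤ ã_n`. The logarithm is added only to match the noise.
      refine IsBigO.trans (IsBigO.add (hω.trans ?_) ?_) hsqrt
      · refine IsBigO.of_bound 2 ?_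
        filter_upwards [hlim1.eventually_lt_const one_pos, hlim2.eventually_lt_const one_pos,
          hã.eventually_pos, ha.eventually_pos, hc.1, ha.tendsto_log.eventually_gt_atTop 0]
          with n h1 h2 h3 h4 h5 h6
        have h7 : 0 < √(ã n) := Real.sqrt_pos.mpr h3
        rw [Real.norm_of_nonneg (by positivity), Real.norm_of_nonneg h7.le]
        rw [mul_assoc, mul_div_assoc, ← div_eq_inv_mul, div_lt_one h7] at h1
        rw [← div_eq_inv_mul, div_lt_one h3] at h2
        have h8 : c n ^ 4 ≤ √(ã n) := Real.le_sqrt_of_sq_le (by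
          rw [← pow_mul]
          exact h2.le)
        linarith
      · refine IsBigO.of_bound 1 ?_
        filter_upwards [hcase.eventually_lt_const one_pos, hã.eventually_pos] with n h1 h2
        rw [Real.norm_of_nonneg (by positivity), Real.norm_of_nonneg (by positivity), one_mul]
        rw [← div_eq_inv_mul, div_lt_one h2] at h1
        exact Real.le_sqrt_of_sq_le (by
          rw [← pow_mul]
          exact h1.le)
    · refine EventuallyEq.isBigO ?_
      filter_upwards [hã.eventually_pos] with n h1
      rw [Real.sqrt_mul h1.le]
  · intro hcase
    obtain ⟨-, hlim⟩ := hstep.case_pos hcase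
    obtain ⟨q', hq', hq'b⟩ := hcase.exists_le
    cases D with
    | fresh δ hδ =>
      -- Here `b_n = 0`, which contradicts a positive limit.
      obtain ⟨n, hn⟩ := hq'b.exists
      simp only [Scheme.b] at hn
      norm_num at hn
      linarith
    | shared S hS =>
      simp only [Scheme.b] at hq'b ⊢
      -- Hence `c_n²` has rate `2 τ ≤ 1 / 2`, below the lower bound `qt` of `n ã_n`, and it can
      -- serve as the bias sequence.
      have hτ := hc.le_quarter (by linarith) hq' hã.eventually_pos hqat hq'b
      have hc2rate : HasRate (τ + τ) fun n => c n ^ 2 := by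
        have := hc.mul hc
        simp only [← sq] at this
        exact this
      have hdom : Dominates 1 ã fun n => c n ^ 2 :=
        hc2rate.dominates hã one_pos (by linarith)
      have hle : ∀ u v : ℕ → ℝ, (∀ n, 0 ≤ u n) → (∀ n, 0 ≤ v n) →
          u =O[atTop] fun n => u n + v n := fun u v hu hv => by
        refine IsBigO.of_bound 1 (Eventually.of_forall fun n => ?_)
        rw [Real.norm_of_nonneg (hu n), Real.norm_of_nonneg (add_nonneg (hu n) (hv n))]
        linarith [hv n]
      refine hR.ae_mu_isBigO hf2 hconv hm hnoise.moment hã hαt2 hαt1 (by linarith)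
        hstep.c_tendsto hdom ?_ ?_ (hle _ _ (fun n => Real.sqrt_nonneg _) fun n => sq_nonneg _)
      · filter_upwards [hθ2] with ω hω
        refine IsBigO.add (hω.trans ?_) (isBigO_refl _ _)
        refine IsBigO.of_bound 2 ?_
        filter_upwards [hlim.eventually_lt_const one_pos, ha.eventually_pos, hc.1,
          ha.tendsto_log.eventually_gt_atTop 0, hstep.c_tendsto.eventually_lt_const one_pos]
          with n h1 h2 h3 h4 h5
        rw [Real.norm_of_nonneg (by positivity), Real.norm_of_nonneg (by positivity)]
        rw [div_lt_one (by positivity)] at h1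
        have h6 : a n * Real.log (partialSum a n) / c n ^ 2 ≤ c n ^ 2 := by
          rw [div_le_iff₀ (by positivity), ← pow_add]
          exact h1.le
        have h7 : c n ^ 4 ≤ c n ^ 2 := pow_le_pow_of_le_one h3.le h5.le (by norm_num)
        linarith
      · refine (hle (fun n => c n ^ 2) (fun n => √(ã n * Real.log (partialSum ã n)))
          (fun n => sq_nonneg _) fun n => Real.sqrt_nonneg _).congr_right fun n => add_comm _ _
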